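/- All functions below are understood through their Laurent expansions at $t=\infty$, with complex coefficients. Let $$w(t)=-\frac1t-\log\Big(1-\frac1t\Big)=\sum_{m\ge2}\frac1m\,t^{-m},$$ let $v(t)=t^{-1}+\tfrac13t^{-2}+\cdots\in\mathbb C[[1/t]]$ be the solution of $\tfrac12v(t)^2=w(t)$ with leading term $t^{-1}$, and let $s(t)=-t+\tfrac23+\cdots$ be the unique solution other than $t$ of $w(s(t))=w(t)$ such that $1/s(t)$ is a power series in $1/t$ without constant term. Let $\hat\xi_n(t)=\sum_{k\ge1}\frac{k^{k+n}}{k!}e^{-k(w+1)}$, $n\ge0$, where $t=1+\sum_{k\ge1}\frac{k^k}{k!}e^{-k(w+1)}$. It is a polynomial in $t$, given by $\hat\xi_0(t)=t-1$ and $\hat\xi_{n+1}(t)=t^2(t-1)\frac{d}{dt}\hat\xi_n(t)$. Define $s_k$ by $$\sum_{k\ge0}s_kz^k=\exp\Big(-\sum_{r\ge1}\frac{B_{2r}}{2r(2r-1)}z^{2r-1}\Big),$$ with $B_{2r}$ the Bernoulli numbers, and for $n\in\mathbb Z$ put $$\eta_n(v)=\frac1v\sum_{k\ge0}s_k\,\frac{(2(n-k)-1)!!}{v^{2(n-k)}},$$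 where the double factorial is extended to negative odd integers by $(-1)!!=1$ and $(2m+1)!!=(2m+1)\,(2m-1)!!$. For an integer $n\ge0$ let $$P_n(t,t_j)\,dt\otimes dt_j=d_{t_j}\left[\frac{t\,s(t)}{t-s(t)}\left(\frac{\hat\xi_{n+1}(t)\,ds(t)}{s(t)-t_j}+\frac{\hat\xi_{n+1}(s(t))\,dt}{t-t_j}\right)\right]_+ ,$$ where $\frac1{t-t_j}=\frac1t\sum_{k\ge0}(t_j/t)^k$ and $\frac1{s(t)-t_j}=\frac1{s(t)}\sum_{k\ge0}(t_j/s(t))^k$, and $[\cdot]_+$ keeps the non-negative powers of $t$. Then $P_n$ is a polynomial in both $t$ and $t_j$, and for every integer $M\ge n+1$ $$P_n(t,t_j)\,dt\otimes dt_j=d_{t_j}\left[\left.\frac{\eta_{n+1}(v_j)}{\eta_{-1}(v)}\cdot\frac1{v^2}\sum_{m=0}^{M}\Big(\frac{v_j}{v}\Big)^{2m}\,v\,dv\,\right|_{v=v(t),\;v_j=v(t_j)}\right]_+ ,$$ where the right-hand side is first evaluated at $v=v(t)$, $v_j=v(t_j)$, then expanded in powers of $1/t$ and $1/t_j$, and finally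 truncated to the part that is polynomial in both $t$ and $t_j$. -/

import Mathlib

namespace Lambert

open PowerSeries

noncomputable section

/-! One-variable Laurent expansions at the point `t = ∞`.

A Laurent series in the local coordinate `u = 1/t` is an element of `LaurentSeries ℂ`; the
coefficient with index `m` is the coefficient of `u ^ m = t ^ (-m)`. -/

/-- `w = ∑_{m ≥ 2} (1/m) t^{-m}`, that is `-1/t - log (1 - 1/t)`, as a power series in `1/t`. -/
def wSeries : PowerSeries ℂ :=
  PowerSeries.mk fun m => if m < 2 then 0 else (1 : ℂ) / m

theorem existsUnique_vSeries :
    ∃! v : PowerSeries ℂ,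
      constantCoeff v = 0 ∧ coeff 1 v = 1 ∧ v ^ 2 = 2 * wSeries := by
  have hb : (PowerSeries.binomialSeries ℂ (1 / 2 : ℚ)) ^ 2 = 1 + X := by
    rw [sq, ← binomialSeries_add]
    have := binomialSeries_nat (R := ℚ) (A := ℂ) 1
    norm_num at this ⊢
    exact this
  set a : PowerSeries ℂ := PowerSeries.mk fun m => if m = 0 then 0 else (2 : ℂ) / (m + 2) with ha
  have ha0 : constantCoeff a = 0 := by
    rw [← coeff_zero_eq_constantCoeff_apply]; simp [ha]
  have hsub : HasSubst a := HasSubst.of_constantCoeff_zero' ha0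
  have hr : ((PowerSeries.binomialSeries ℂ (1 / 2 : ℚ)).subst a) ^ 2 = 1 + a := by
    rw [← subst_pow hsub, hb, subst_add hsub, subst_X hsub]
    congr 1
    rw [← coe_substAlgHom hsub, map_one]
  set r : PowerSeries ℂ := (PowerSeries.binomialSeries ℂ (1 / 2 : ℚ)).subst a with hrdef
  have hw : 2 * wSeries = X ^ 2 * (1 + a) := by
    ext m
    rcases m with _ | _ | m
    · simp [wSeries]
    · rw [coeff_X_pow_mul']; simp [wSeries]
      have : (2 : PowerSeries ℂ) = C (2 : ℂ) := (map_ofNat C 2).symm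
      rw [this, coeff_C_mul]; simp
    · have : (2 : PowerSeries ℂ) = C (2 : ℂ) := (map_ofNat C 2).symm
      rw [this, coeff_C_mul, coeff_X_pow_mul']
      simp only [wSeries, coeff_mk, ha, map_add, coeff_one]
      rcases m with _ | m
      · norm_num
      · have : ((m : ℂ) + 1 + 1 + 1) ≠ 0 := by exact_mod_cast Nat.succ_ne_zero (m + 2)
        have h3 : ((m : ℂ) + 1 + 2) ≠ 0 := by
          intro h
          apply this
          rw [← h]
          ring
        simp
        field_simp
        ring
  have hr0 : constantCoeff r = 1 ∨ constantCoeff r = -1 := by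
    have := congrArg constantCoeff hr
    simp [ha0] at this
    exact this
  obtain ⟨q, hq0, hq⟩ : ∃ q : PowerSeries ℂ, constantCoeff q = 1 ∧ q ^ 2 = 1 + a := by
    rcases hr0 with h | h
    · exact ⟨r, h, hr⟩
    · exact ⟨-r, by simp [h], by rw [neg_sq, hr]⟩
  refine ⟨X * q, ⟨by simp, ?_, by rw [mul_pow, hq, hw]⟩, ?_⟩
  · have := coeff_succ_X_mul 0 q
    rw [zero_add, coeff_zero_eq_constantCoeff_apply, hq0] at this
    exact this
  · rintro v ⟨-, hv1, hv⟩
    have h2 : v ^ 2 = (X * q) ^ 2 := by rw [hv, mul_pow, hq, hw]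
    rcases sq_eq_sq_iff_eq_or_eq_neg.mp h2 with h | h
    · exact h
    · exfalso
      have h1 := congrArg (coeff 1) h
      have h3 := coeff_succ_X_mul 0 q
      rw [zero_add, coeff_zero_eq_constantCoeff_apply, hq0] at h3
      rw [hv1, map_neg, h3] at h1
      norm_num at h1

/-- The Airy coordinate `v(t) = t^{-1} + (1/3) t^{-2} + ⋯`: the solution of `v ^ 2 / 2 = w` with
leading term `t^{-1}`, as a power series in `1/t`. -/
def vSeries : PowerSeries ℂ := existsUnique_vSeries.choose

theorem vSeries_spec :
    constantCoeff vSeries = 0 ∧ coeff 1 vSeries = 1 ∧ vSeries ^ 2 = 2 * wSeries :=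
  existsUnique_vSeries.choose_spec.1

theorem existsUnique_sInvSeries :
    ∃! σ : PowerSeries ℂ,
      constantCoeff σ = 0 ∧ σ ≠ X ∧ wSeries.subst σ = wSeries := by
  obtain ⟨hv0, hv1, hv2⟩ := vSeries_spec
  have hu : IsUnit (coeff 1 vSeries) := by rw [hv1]; exact isUnit_one
  set i := vSeries.substInvOfIsUnit hu with hi
  have hi0 : constantCoeff i = 0 := constantCoeff_substInvOfIsUnit _ hu
  have hir : vSeries.subst i = X := subst_substInvOfIsUnit_right _ hv0 hu
  have hil : i.subst vSeries = X := subst_substInvOfIsUnit_left _ hv0 hu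
  have hv : HasSubst vSeries := HasSubst.of_constantCoeff_zero' hv0
  have hI : HasSubst i := HasSubst.of_constantCoeff_zero' hi0
  have hn : HasSubst (-vSeries) := HasSubst.of_constantCoeff_zero' (by simp [hv0])
  have h20 : (2 : PowerSeries ℂ) ≠ 0 := fun h => by
    have h1 := congrArg constantCoeff h
    rw [map_ofNat, map_zero] at h1
    norm_num at h1
  have htwo : ∀ f g : PowerSeries ℂ, 2 * f = 2 * g → f = g := fun f g h =>
    mul_left_cancel₀ h20 h
  -- the two solutions of `v(σ) ^ 2 = v ^ 2`
  have key : ∀ σ : PowerSeries ℂ, constantCoeff σ = 0 →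
      (wSeries.subst σ = wSeries ↔ (vSeries.subst σ) ^ 2 = vSeries ^ 2) := by
    intro σ hσ
    have hs : HasSubst σ := HasSubst.of_constantCoeff_zero' hσ
    have h2 : (2 * wSeries).subst σ = 2 * wSeries.subst σ := by
      rw [two_mul, subst_add hs, two_mul]
    rw [← subst_pow hs, hv2, h2]
    exact ⟨fun h => by rw [h], fun h => htwo _ _ h⟩
  -- `σ` is recovered from `v(σ)`
  have inj : ∀ σ : PowerSeries ℂ, constantCoeff σ = 0 → i.subst (vSeries.subst σ) = σ := by
    intro σ hσ
    have hs : HasSubst σ := HasSubst.of_constantCoeff_zero' hσ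
    rw [← subst_comp_subst_apply hv hs, hil, subst_X hs]
  have hc : constantCoeff (i.subst (-vSeries) : PowerSeries ℂ) = 0 :=
    constantCoeff_subst_eq_zero (by
      change constantCoeff (-vSeries) = 0
      simp [hv0]) _ hi0
  have hvs : vSeries.subst (i.subst (-vSeries) : PowerSeries ℂ) = -vSeries := by
    rw [← subst_comp_subst_apply hI hn, hir, subst_X hn]
  refine ⟨i.subst (-vSeries), ⟨hc, ?_, ?_⟩, ?_⟩
  · intro h
    rw [h, ← map_algebraMap_eq_subst_X] at hvs
    have h1 := congrArg (coeff 1) hvs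
    simp [hv1] at h1
    norm_num at h1
  · rw [key _ hc, hvs, neg_sq]
  · rintro σ ⟨hσ0, hσX, hσ⟩
    rcases sq_eq_sq_iff_eq_or_eq_neg.mp ((key σ hσ0).mp hσ) with h | h
    · exact absurd (by rw [← inj σ hσ0, h, hil]) hσX
    · rw [← inj σ hσ0, h]

/-- The expansion of `1 / s(t)` in powers of `1/t`, where `s` is the deck transformation near
`t = ∞` of the `w`-projection: the only solution `s(t) ≠ t` of `w(s(t)) = w(t)` near `∞`. -/
def sInvSeries : PowerSeries ℂ := existsUnique_sInvSeries.choose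

theorem sInvSeries_spec :
    constantCoeff sInvSeries = 0 ∧ sInvSeries ≠ X ∧ wSeries.subst sInvSeries = wSeries :=
  existsUnique_sInvSeries.choose_spec.1

/-- The coordinate `t` itself, `t = u⁻¹`. -/
def tL : LaurentSeries ℂ := HahnSeries.single (-1 : ℤ) (1 : ℂ)

/-- The Laurent expansion at `t = ∞` of `v(t)`. -/
def vL : LaurentSeries ℂ := HahnSeries.ofPowerSeries ℤ ℂ vSeries

/-- The Laurent expansion at `t = ∞` of `s(t) = -t + 2/3 + ⋯`. -/
def sL : LaurentSeries ℂ := (HahnSeries.ofPowerSeries ℤ ℂ sInvSeries)⁻¹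

/-- The derivative `d/dt` of a Laurent series in `u = 1/t`, that is `-u ^ 2 * d/du`. -/
def ddt (f : LaurentSeries ℂ) : LaurentSeries ℂ :=
  -(HahnSeries.single (2 : ℤ) (1 : ℂ) * LaurentSeries.derivative ℂ f)

/-- The polynomials `ξ̂_n(t)`, `n ≥ 0`: `ξ̂_0 = t - 1` and `ξ̂_{n+1} = t ^ 2 (t - 1) dξ̂_n/dt`. -/
def xiHat : ℕ → Polynomial ℂ
  | 0 => Polynomial.X - 1
  | n + 1 => Polynomial.X ^ 2 * (Polynomial.X - 1) * Polynomial.derivative (xiHat n)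

/-- `t = 1 + ∑_{k ≥ 1} (k^k / k!) x^k` as a power series in `x = e^{-(w+1)}`. -/
def tOfX : PowerSeries ℂ := PowerSeries.mk fun k => (k : ℂ) ^ k / (Nat.factorial k : ℂ)

theorem X_mul_derivative_tOfX :
    X * derivative ℂ tOfX = tOfX ^ 2 * (tOfX - 1) := by
  set E : PowerSeries ℂ := rescale (-1 : ℂ) (exp ℂ) with hE
  set b : PowerSeries ℂ := X * E with hb
  set W : PowerSeries ℂ := PowerSeries.mk fun k => (k : ℂ) ^ (k - 1) / (Nat.factorial k : ℂ) -
    (if k = 0 then 1 else 0) with hW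
  have hb0 : constantCoeff b = 0 := by simp [hb]
  have hs : HasSubst b := HasSubst.of_constantCoeff_zero' hb0
  have hE0 : constantCoeff E = 1 := by
    rw [← coeff_zero_eq_constantCoeff_apply, hE, coeff_rescale]; simp
  have hb1 : coeff 1 b = 1 := by
    have := coeff_succ_X_mul 0 E
    rw [zero_add, coeff_zero_eq_constantCoeff_apply, hE0] at this
    exact this
  have hEd : derivative ℂ E = -E := by
    ext n
    rw [coeff_derivative, hE, coeff_rescale, map_neg, coeff_rescale, coeff_exp, coeff_exp]
    have h1 : ((n : ℂ) + 1) ≠ 0 := by exact_mod_cast Nat.succ_ne_zero n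
    have h2 : (Nat.factorial n : ℂ) ≠ 0 := by exact_mod_cast Nat.factorial_ne_zero n
    simp [Nat.factorial_succ, pow_succ]
    field_simp
  have hbd : derivative ℂ b = E * (1 - X) := by
    rw [hb, Derivation.leibniz, hEd, derivative_X]
    simp only [smul_eq_mul]
    ring
  -- the Lambert function inverts `y e^{-y}`
  have hWb : W.subst b = X := by
    ext e
    have hpow : ∀ d : ℕ, b ^ d = X ^ d * rescale (-(d : ℂ)) (exp ℂ) := by
      intro d
      rw [hb, mul_pow, hE, ← map_pow, exp_pow_eq_rescale_exp, rescale_rescale]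
      simp
    have hco : ∀ d : ℕ, coeff e (b ^ d) =
        if d ≤ e then (-(d : ℂ)) ^ (e - d) / (Nat.factorial (e - d) : ℂ) else 0 := by
      intro d
      rw [hpow, coeff_X_pow_mul']
      split_ifs with h
      · rw [coeff_rescale, coeff_exp]; simp [div_eq_mul_inv]
      · rfl
    rw [coeff_subst' hs, finsum_eq_sum_of_support_subset (s := Finset.range (e + 1))]
    swap
    · intro d hd
      by_contra h
      apply hd
      simp at h
      simp only [hco, if_neg (show ¬ d ≤ e by omega), smul_zero]
    have hterm : ∀ d ∈ Finset.range (e + 1), coeff d W • coeff e (b ^ d) =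
        (1 / (Nat.factorial e : ℂ)) *
          (if d = 0 then 0 else (-1 : ℂ) ^ (e - d) * (e.choose d : ℂ) * (d : ℂ) ^ (e - 1)) := by
      intro d hd
      have hde : d ≤ e := by simp at hd; omega
      rw [hco, if_pos hde, hW, coeff_mk]
      rcases Nat.eq_zero_or_pos d with rfl | hdpos
      · simp
      · rw [if_neg hdpos.ne', if_neg hdpos.ne', Nat.cast_choose ℂ hde]
        have h1 : (Nat.factorial e : ℂ) ≠ 0 := by exact_mod_cast Nat.factorial_ne_zero e
        have h2 : (Nat.factorial d : ℂ) ≠ 0 := by exact_mod_cast Nat.factorial_ne_zero d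
        have h3 : (Nat.factorial (e - d) : ℂ) ≠ 0 := by
          exact_mod_cast Nat.factorial_ne_zero (e - d)
        have h4 : (d : ℂ) ^ (e - 1) = (d : ℂ) ^ (d - 1) * (d : ℂ) ^ (e - d) := by
          rw [← pow_add]; congr 1; omega
        rw [h4, neg_pow (d : ℂ) (e - d), smul_eq_mul]
        field_simp
        ring
    rw [Finset.sum_congr rfl hterm, ← Finset.mul_sum]
    rcases e with _ | _ | e
    · simp
    · simp [Finset.sum_range_succ]
    · have h0 := congrFun (fwdDiff_iter_pow_eq_zero_of_lt (R := ℂ)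
        (show e + 1 < e + 2 by omega)) 0
      rw [fwdDiff_iter_eq_sum_shift] at h0
      have hX : coeff (e + 1 + 1) (X : PowerSeries ℂ) = 0 := by
        rw [coeff_X, if_neg (by omega)]
      rw [hX]
      apply mul_eq_zero_of_right
      rw [Pi.zero_apply] at h0
      refine (Finset.sum_congr rfl fun d _ => ?_).trans h0
      split_ifs with h
      · simp [h]
      · simp
  -- the operator `x d/dx` in the coordinate `y`
  have hop : ∀ F : PowerSeries ℂ, (X * derivative ℂ F).subst b * (1 - X) =
      X * derivative ℂ (F.subst b : PowerSeries ℂ) := by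
    intro F
    rw [derivative_subst hs, subst_mul hs, subst_X hs, hbd, hb]
    ring
  have htW : X * derivative ℂ W = tOfX - 1 := by
    ext k
    rcases k with _ | k
    · simp [tOfX]
    · rw [coeff_succ_X_mul, coeff_derivative, hW, coeff_mk, map_sub, tOfX, coeff_mk, coeff_one]
      simp [pow_succ]
      ring
  have hone : (1 : PowerSeries ℂ).subst b = (1 : PowerSeries ℂ) := by
    rw [← coe_substAlgHom hs, map_one]
  have hT : (tOfX.subst b : PowerSeries ℂ) * (1 - X) = 1 := by
    have := hop W
    rw [htW, hWb, derivative_X, subst_sub hs, hone] at this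
    linear_combination this
  set T : PowerSeries ℂ := tOfX.subst b with hTdef
  have hTd : derivative ℂ T * (1 - X) = T := by
    have := congrArg (derivative ℂ) hT
    rw [Derivation.leibniz, map_sub, derivative_X, derivative_one] at this
    simp only [smul_eq_mul] at this
    linear_combination this
  have hne : (1 - X : PowerSeries ℂ) ≠ 0 := right_ne_zero_of_mul (hT ▸ one_ne_zero)
  have hfin : (X * derivative ℂ tOfX).subst b =
      ((tOfX ^ 2 * (tOfX - 1)).subst b : PowerSeries ℂ) := by
    rw [subst_mul hs (tOfX ^ 2), subst_pow hs, subst_sub hs, hone, ← hTdef]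
    apply mul_right_cancel₀ (pow_ne_zero 2 hne)
    have := hop tOfX
    rw [← hTdef] at this
    linear_combination (1 - X) * this + X * hTd - (T * (1 - X) + 1) * (T - 1) * hT - hT
  have hu : IsUnit (coeff 1 b) := by rw [hb1]; exact isUnit_one
  have hI : HasSubst (b.substInvOfIsUnit hu) :=
    HasSubst.of_constantCoeff_zero' (constantCoeff_substInvOfIsUnit _ hu)
  have := congrArg (fun F : PowerSeries ℂ => (F.subst (b.substInvOfIsUnit hu) : PowerSeries ℂ)) hfin
  simp only [subst_comp_subst_apply hs hI, subst_substInvOfIsUnit_right _ hb0 hu, X_subst] at this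
  exact this

/-- As functions of `x = e^{-(w+1)}`, `ξ̂_n(t) = ∑_{k ≥ 1} (k^{k+n} / k!) e^{-k(w+1)}`. -/
theorem aeval_tOfX_xiHat (n : ℕ) :
    Polynomial.aeval tOfX (xiHat n) = PowerSeries.mk fun k =>
      if k = 0 then 0 else (k : ℂ) ^ (k + n) / (Nat.factorial k : ℂ) := by
  induction n with
  | zero =>
    ext k
    rcases k with _ | k <;> simp [xiHat, tOfX, coeff_one]
  | succ n ih =>
    have h : Polynomial.aeval tOfX (xiHat (n + 1)) =
        X * derivative ℂ (Polynomial.aeval tOfX (xiHat n)) := by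
      rw [Derivation.map_aeval, xiHat]
      simp only [map_mul, map_pow, map_sub, map_one, Polynomial.aeval_X, smul_eq_mul]
      rw [← X_mul_derivative_tOfX]
      ring
    rw [h, ih]
    ext k
    rcases k with _ | k
    · simp
    · rw [coeff_succ_X_mul, coeff_derivative]
      simp
      ring

/-- The value `ξ̂_n(f)` at a Laurent series `f`. -/
def xiHatAt (n : ℕ) (f : LaurentSeries ℂ) : LaurentSeries ℂ := Polynomial.aeval f (xiHat n)

/-! The Laurent series `η_n(v)`. -/

/-- The exponent `-∑_{r ≥ 1} B_{2r} / (2r(2r-1)) z^{2r-1}` of the Stirling expansion. -/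
def stirlingExponent : PowerSeries ℂ :=
  PowerSeries.mk fun k => if Odd k then -((bernoulli (k + 1) : ℚ) : ℂ) / ((k + 1) * k) else 0

/-- The Stirling coefficients `s_k`:
`∑_k s_k z^k = exp (-∑_{r ≥ 1} B_{2r} / (2r(2r-1)) z^{2r-1})`. -/
def stirlingCoeff (k : ℕ) : ℂ := coeff k ((exp ℂ).subst stirlingExponent)

/-- The double factorial `(2m - 1)!!` for every integer `m`: the usual product
`1 · 3 ⋯ (2m - 1)` for `m ≥ 0`, and `(-2j - 1)!! = (-1)^j / (2j - 1)!!` for `m = -j ≤ 0`. -/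
def oddDoubleFactorial : ℤ → ℂ
  | Int.ofNat m => ∏ i ∈ Finset.range m, (2 * (i : ℂ) + 1)
  | Int.negSucc j => (-1) ^ (j + 1) / ∏ i ∈ Finset.range (j + 1), (2 * (i : ℂ) + 1)

theorem oddDoubleFactorial_zero : oddDoubleFactorial 0 = 1 := by
  change oddDoubleFactorial (Int.ofNat 0) = 1
  simp [oddDoubleFactorial]

/-- The recursion `(2m + 1)!! = (2m + 1) (2m - 1)!!` holds for all integers `m`. -/
theorem oddDoubleFactorial_succ (m : ℤ) :
    oddDoubleFactorial (m + 1) = (2 * (m : ℂ) + 1) * oddDoubleFactorial m := by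
  rcases m with m | j
  · change oddDoubleFactorial (Int.ofNat (m + 1)) = _
    simp [oddDoubleFactorial, Finset.prod_range_succ, mul_comm]
  · have hne : ∀ k : ℕ, (2 * (k : ℂ) + 1) ≠ 0 := fun k => by exact_mod_cast Nat.succ_ne_zero (2 * k)
    have hp : ∀ k : ℕ, (∏ i ∈ Finset.range k, (2 * (i : ℂ) + 1)) ≠ 0 := fun k =>
      Finset.prod_ne_zero_iff.mpr fun i _ => hne i
    rcases j with _ | j
    · change oddDoubleFactorial (Int.ofNat 0) = _
      simp [oddDoubleFactorial]
      norm_num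
    · have : (Int.negSucc (j + 1) + 1) = Int.negSucc j := by omega
      rw [this]
      simp only [oddDoubleFactorial]
      rw [Finset.prod_range_succ _ (j + 1), Int.cast_negSucc]
      have h1 := hp (j + 1)
      have h2 := hne (j + 1)
      push_cast at h2 ⊢
      field_simp
      ring

/-- `η_n(v) = v^{-1} ∑_{k ≥ 0} s_k (2(n-k)-1)!! v^{-2(n-k)}`, a Laurent series in `v`: its
coefficient at `v^{2k - (2n+1)}` is `s_k (2(n-k)-1)!!`, and all others vanish. -/
def eta (n : ℤ) : LaurentSeries ℂ :=
  HahnSeries.single (-(2 * n + 1)) (1 : ℂ) *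
    HahnSeries.ofPowerSeries ℤ ℂ
      (PowerSeries.mk fun j =>
        if Even j then stirlingCoeff (j / 2) * oddDoubleFactorial (n - (j / 2 : ℕ)) else 0)

/-- Substitution `f(g(u))` of a power series `g` without constant term into a Laurent series. -/
def laurentSubst (f : LaurentSeries ℂ) (g : PowerSeries ℂ) : LaurentSeries ℂ :=
  (HahnSeries.ofPowerSeries ℤ ℂ g) ^ f.order *
    HahnSeries.ofPowerSeries ℤ ℂ (f.powerSeriesPart.subst g)

/-- The Laurent expansion of `η_n(v(t))` in powers of `1/t`. -/
def etaL (n : ℤ) : LaurentSeries ℂ := laurentSubst (eta n) vSeries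

/-! Expansions in two variables. The field `ℂ((1/t_j))((1/t))` of Laurent series in `1/t` whose
coefficients are Laurent series in `1/t_j` is `LaurentSeries (LaurentSeries ℂ)`. In this field
`1 / (t - t_j) = (1/t) ∑_{k ≥ 0} (t_j / t)^k`. -/

/-- A Laurent series in `1/t`, as an element of `ℂ((1/t_j))((1/t))`. -/
def inT (f : LaurentSeries ℂ) : LaurentSeries (LaurentSeries ℂ) :=
  HahnSeries.map f (HahnSeries.C : ℂ →+* LaurentSeries ℂ)

/-- A Laurent series in `1/t_j`, as an element of `ℂ((1/t_j))((1/t))`. -/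
def inTj (f : LaurentSeries ℂ) : LaurentSeries (LaurentSeries ℂ) := HahnSeries.C f

/-- The polynomial part `[∑ a_m t^m]_+ = ∑_{m ≥ 0} a_m t^m` of a Laurent series in `1/t`. -/
def polyPart {R : Type*} [Semiring R] (f : LaurentSeries R) : Polynomial R :=
  ∑ k ∈ Finset.range ((-f.order).toNat + 1), Polynomial.monomial k (f.coeff (-(k : ℤ)))

theorem coeff_polyPart {R : Type*} [Semiring R] (f : LaurentSeries R) (k : ℕ) :
    (polyPart f).coeff k = f.coeff (-(k : ℤ)) := by
  simp only [polyPart, Polynomial.finsetSum_coeff, Polynomial.coeff_monomial]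
  rw [Finset.sum_ite_eq' ]
  split_ifs with h
  · rfl
  · symm
    apply HahnSeries.coeff_eq_zero_of_lt_order
    simp at h
    omega

/-- Application of a map to every coefficient of a polynomial. -/
def mapCoeffs {A B : Type*} [Semiring A] [Semiring B] (g : A → B) (p : Polynomial A) :
    Polynomial B :=
  ∑ k ∈ p.support, Polynomial.monomial k (g (p.coeff k))

theorem coeff_mapCoeffs {A B : Type*} [Semiring A] [Semiring B] (g : A → B) (hg : g 0 = 0)
    (p : Polynomial A) (k : ℕ) : (mapCoeffs g p).coeff k = g (p.coeff k) := by
  simp only [mapCoeffs, Polynomial.finsetSum_coeff, Polynomial.coeff_monomial]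
  rw [Finset.sum_ite_eq']
  split_ifs with h
  · rfl
  · rw [Polynomial.notMem_support_iff.mp h, hg]

/-- The part of an element of `ℂ((1/t_j))((1/t))` that is polynomial in both `t` and `t_j`: a
polynomial in `t` with coefficients in `ℂ[t_j]`. -/
def polyPart₂ (f : LaurentSeries (LaurentSeries ℂ)) : Polynomial (Polynomial ℂ) :=
  mapCoeffs polyPart (polyPart f)

/-- The coefficient of `dt` in the `1`-form
`(t s(t) / (t - s(t))) (ξ̂_{n+1}(t) ds(t) / (s(t) - t_j) + ξ̂_{n+1}(s(t)) dt / (t - t_j))`. -/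
def kernelForm (n : ℕ) : LaurentSeries (LaurentSeries ℂ) :=
  inT tL * inT sL / (inT tL - inT sL) *
    (inT (xiHatAt (n + 1) tL) * inT (ddt sL) / (inT sL - inTj tL) +
      inT (xiHatAt (n + 1) sL) / (inT tL - inTj tL))

/-- The residue polynomial `P_n(t, t_j)`, a polynomial in `t` with coefficients in `ℂ[t_j]`:
`P_n dt ⊗ dt_j` is `d_{t_j}` of the polynomial part of the kernel form. -/
def residuePoly (n : ℕ) : Polynomial (Polynomial ℂ) :=
  mapCoeffs Polynomial.derivative (polyPart₂ (kernelForm n))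

/-- The coefficient of `dt` in the `1`-form
`(η_{n+1}(v_j) / η_{-1}(v)) v^{-2} ∑_{m=0}^{M} (v_j / v)^{2m} v dv` at `v = v(t)`,
`v_j = v(t_j)`. -/
def etaForm (n M : ℕ) : LaurentSeries (LaurentSeries ℂ) :=
  inTj (etaL (n + 1)) / inT (etaL (-1)) *
    (1 / inT vL ^ 2 * ∑ m ∈ Finset.range (M + 1), (inTj vL / inT vL) ^ (2 * m)) *
    (inT vL * inT (ddt vL))

end

end Lambert

namespace Lambert

open PowerSeries

noncomputable section

/-! ### The inverse of the Airy coordinate -/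

/-! Write u = 1/t and let u(v) be the inverse of v(t). Since w = v²/2, the deck transformation is v
↦ -v, so 1/t = u(v) and 1/s = u(-v).

The link with η is that 1/s - 1/t = 2η_{-1}(v) (`two_etaL_neg_one`), which says that the odd
coefficients of u(v) are Stirling coefficients divided by double factorials (`coeff_uSeries_odd`).
These coefficients are the moments in the saddle-point expansion of ∫ e^{-w(u)/z} du, that is of Γ(1
+ 1/z). A formal version of this integral is built; integration by parts gives the averages of
(1-u)^c as ∏(1 + iz); differentiating in c at 0 gives the average of log(1-u) = -(w+u) through
Bernoulli numbers, and hence the logarithmic derivative in z of the Stirling series.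

The operator -d/dw raises the index of η_n, of ξ̂_n(t) and of ξ̂_n(s). Therefore 2η_n = ξ̂_n(t) -
ξ̂_n(s) for all n ≥ 0 (`two_etaL`), while ξ̂_n(t) + ξ̂_n(s) is a power series in v²
(`exists_xiHatAt_add`).

At t_j^k with k ≥ 1, the kernel is -1/k times (ξ̂(t) d(s^{-k}) + ξ̂(s) d(t^{-k})) / (2η_{-1}), with
ξ̂ = ξ̂_{n+1}. Splitting ξ̂ into half sum and half difference, the half sum contributes only
negative powers of t. The half difference leaves η_{n+1} d(t^{-k} - s^{-k}), whose principal part in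
v is computed by residues (`coeff_etaL_mul`, `exists_etaL_mul_ddt`); it is exactly what the
η-expression gives. The power t_j^0 is killed by d_{t_j}. -/

theorem isUnit_coeff_one_vSeries : IsUnit (coeff 1 vSeries) := by
  rw [vSeries_spec.2.1]; exact isUnit_one

/-- The expansion of `u = 1/t` in powers of the Airy coordinate `v`. -/
def uSeries : PowerSeries ℂ := vSeries.substInvOfIsUnit isUnit_coeff_one_vSeries

theorem constantCoeff_uSeries : constantCoeff uSeries = 0 :=
  constantCoeff_substInvOfIsUnit _ _

theorem hasSubst_uSeries : HasSubst uSeries :=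
  HasSubst.of_constantCoeff_zero' constantCoeff_uSeries

theorem hasSubst_vSeries : HasSubst vSeries :=
  HasSubst.of_constantCoeff_zero' vSeries_spec.1

theorem vSeries_subst_uSeries : vSeries.subst uSeries = (X : PowerSeries ℂ) :=
  subst_substInvOfIsUnit_right _ vSeries_spec.1 _

theorem uSeries_subst_vSeries : uSeries.subst vSeries = (X : PowerSeries ℂ) :=
  subst_substInvOfIsUnit_left _ vSeries_spec.1 _

theorem coeff_one_uSeries : coeff 1 uSeries = 1 := by
  have h : isUnit_coeff_one_vSeries.unit = 1 := Units.ext vSeries_spec.2.1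
  rw [uSeries, coeff_one_substInvOfIsUnit, h]
  simp

theorem one_subst {g : PowerSeries ℂ} (hg : HasSubst g) :
    (1 : PowerSeries ℂ).subst g = (1 : PowerSeries ℂ) := by
  rw [← coe_substAlgHom hg, map_one]

theorem two_mul_wSeries_subst_uSeries :
    2 * (wSeries.subst uSeries : PowerSeries ℂ) = X ^ 2 := by
  have h := subst_pow hasSubst_uSeries vSeries 2
  rw [vSeries_spec.2.2, vSeries_subst_uSeries, two_mul, subst_add hasSubst_uSeries] at h
  rw [two_mul, h]

theorem derivative_wSeries_mul : derivative ℂ wSeries * (1 - X) = X := by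
  ext m
  have hc : ∀ j : ℕ, coeff j (derivative ℂ wSeries) = if j = 0 then 0 else 1 := by
    intro j
    rw [coeff_derivative, wSeries, coeff_mk]
    rcases j with _ | j
    · simp
    · have : ((j : ℂ) + 1 + 1) ≠ 0 := by exact_mod_cast Nat.succ_ne_zero (j + 1)
      simp [this]
  rw [mul_sub, mul_one, map_sub, hc]
  rcases m with _ | _ | m
  · simp [coeff_X]
  · rw [coeff_succ_mul_X, hc]; simp
  · rw [coeff_succ_mul_X, hc, coeff_X]; simp

/-- Differentiate w(u(v)) = v²/2 and use dw/du = u/(1-u). -/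
theorem uSeries_mul_derivative :
    uSeries * derivative ℂ uSeries = X * (1 - uSeries) := by
  have h1 := congrArg (derivative ℂ) two_mul_wSeries_subst_uSeries
  rw [Derivation.leibniz, derivative_subst hasSubst_uSeries, derivative_pow, derivative_X] at h1
  have h2 := congrArg (fun f : PowerSeries ℂ => (f.subst uSeries : PowerSeries ℂ))
    derivative_wSeries_mul
  simp only [subst_mul hasSubst_uSeries, subst_sub hasSubst_uSeries, one_subst hasSubst_uSeries,
    subst_X hasSubst_uSeries] at h2
  have h0 : derivative ℂ (2 : PowerSeries ℂ) = 0 := by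
    rw [← map_ofNat (C (R := ℂ)) 2, derivative_C]
  rw [h0] at h1
  have h3 : (2 : PowerSeries ℂ) ≠ 0 := by
    rw [← map_ofNat (C (R := ℂ)) 2, Ne, map_eq_zero_iff _ C_injective]
    exact two_ne_zero
  apply mul_left_cancel₀ h3
  simp only [smul_eq_mul] at h1
  push_cast at h1
  linear_combination (1 - uSeries) * h1 - 2 * derivative ℂ uSeries * h2

/-! ### The formal Gaussian integral -/

/-- `(2k - 1)!!` as a complex number. -/
def oddFactorial (k : ℕ) : ℂ := ∏ i ∈ Finset.range k, (2 * (i : ℂ) + 1)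

theorem oddFactorial_succ (k : ℕ) : oddFactorial (k + 1) = (2 * (k : ℂ) + 1) * oddFactorial k := by
  rw [oddFactorial, Finset.prod_range_succ, mul_comm, oddFactorial]

theorem oddFactorial_ne_zero (k : ℕ) : oddFactorial k ≠ 0 :=
  Finset.prod_ne_zero_iff.mpr fun i _ => by exact_mod_cast Nat.succ_ne_zero (2 * i)

/-- The normalized formal Gaussian integral `∫ h(v) e^{-v²/(2z)} dv`, which sends `v ^ (2k)` to
`(2k - 1)!! z ^ k` and odd powers to zero. -/
def gaussIntegral : PowerSeries ℂ →ₗ[ℂ] PowerSeries ℂ where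
  toFun h := PowerSeries.mk fun k => oddFactorial k * coeff (2 * k) h
  map_add' f g := by ext k; simp [mul_add]
  map_smul' c f := by ext k; simp; ring

theorem coeff_gaussIntegral (h : PowerSeries ℂ) (k : ℕ) :
    coeff k (gaussIntegral h) = oddFactorial k * coeff (2 * k) h := by
  simp [gaussIntegral]

/-- Integration by parts, since v e^{-v²/(2z)} = -z d(e^{-v²/(2z)})/dv. -/
theorem gaussIntegral_X_mul (h : PowerSeries ℂ) :
    gaussIntegral (X * h) = X * gaussIntegral (derivative ℂ h) := by
  ext k
  rcases k with _ | k
  · simp [coeff_gaussIntegral]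
  · rw [coeff_succ_X_mul, coeff_gaussIntegral, coeff_gaussIntegral, coeff_derivative,
      oddFactorial_succ, show 2 * (k + 1) = (2 * k + 1) + 1 by ring, coeff_succ_X_mul]
    push_cast
    ring

/-- Differentiation under the integral sign: v²/2 is brought down by z² d/dz. The undifferentiated
term comes from the normalizing factor z^{-1/2}. -/
theorem gaussIntegral_X_sq_mul (h : PowerSeries ℂ) :
    gaussIntegral (X ^ 2 * h) =
      X * (gaussIntegral h + 2 * (X * derivative ℂ (gaussIntegral h))) := by
  ext k
  have h2 : ∀ f : PowerSeries ℂ, ∀ j, coeff j (2 * f) = 2 * coeff j f := fun f j => by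
    rw [← map_ofNat (C (R := ℂ)) 2, coeff_C_mul]
  rcases k with _ | k
  · simp [coeff_gaussIntegral, coeff_X_pow_mul']
  · rw [coeff_succ_X_mul, coeff_gaussIntegral, map_add, h2, oddFactorial_succ,
      show 2 * (k + 1) = 2 * k + 2 by ring, coeff_X_pow_mul, coeff_gaussIntegral]
    rcases k with _ | k
    · simp
    · rw [coeff_succ_X_mul, coeff_derivative, coeff_gaussIntegral]
      push_cast
      ring

/-- The integral `∫ f(u) e^{-w(u)/z} du`, normalized, as a formal series in `z`. -/
def gammaIntegral : PowerSeries ℂ →ₗ[ℂ] PowerSeries ℂ where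
  toFun f := gaussIntegral (f.subst uSeries * derivative ℂ uSeries)
  map_add' f g := by rw [subst_add hasSubst_uSeries, add_mul, map_add]
  map_smul' c f := by
    rw [subst_smul hasSubst_uSeries, smul_mul_assoc, map_smul, RingHom.id_apply]

theorem gammaIntegral_apply (f : PowerSeries ℂ) :
    gammaIntegral f = gaussIntegral (f.subst uSeries * derivative ℂ uSeries) := rfl

/-- Integration by parts in u: as u du = (1-u) v dv, the Gaussian rule applies to (1-u) f(u). -/
theorem gammaIntegral_X_mul (f : PowerSeries ℂ) :
    gammaIntegral (X * f) = X * gammaIntegral ((1 - X) * derivative ℂ f - f) := by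
  have hu := hasSubst_uSeries
  have h1 : (X * f).subst uSeries * derivative ℂ uSeries =
      X * ((1 - X) * f).subst uSeries := by
    rw [subst_mul hu, subst_mul hu, subst_sub hu, one_subst hu, subst_X hu]
    linear_combination (f.subst uSeries) * uSeries_mul_derivative
  rw [gammaIntegral_apply, h1, gaussIntegral_X_mul, derivative_subst hu, gammaIntegral_apply]
  congr 4
  rw [Derivation.leibniz, map_sub, derivative_X, derivative_one]
  simp only [smul_eq_mul]
  ring

/-- The formal Stirling series, `Γ(1 + 1/z)` divided by its leading asymptotics. -/
def gammaSeries : PowerSeries ℂ := gammaIntegral 1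

theorem gammaSeries_eq : gammaSeries = gaussIntegral (derivative ℂ uSeries) := by
  rw [gammaSeries, gammaIntegral_apply, one_subst hasSubst_uSeries, one_mul]

theorem coeff_gammaSeries (k : ℕ) :
    coeff k gammaSeries = oddFactorial (k + 1) * coeff (2 * k + 1) uSeries := by
  rw [gammaSeries_eq, coeff_gaussIntegral, coeff_derivative, oddFactorial_succ]
  push_cast
  ring

theorem constantCoeff_gammaSeries : constantCoeff gammaSeries = 1 := by
  rw [← coeff_zero_eq_constantCoeff_apply, coeff_gammaSeries, mul_zero, zero_add,
    coeff_one_uSeries]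
  simp [oddFactorial]

theorem gammaIntegral_X : gammaIntegral X = -(X * gammaSeries) := by
  have := gammaIntegral_X_mul 1
  rw [mul_one, derivative_one, mul_zero, zero_sub, map_neg] at this
  rw [this, gammaSeries, mul_neg]

/-- The insertion of w is a derivative in z; this yields the differential equation for
`gammaSeries`. -/
theorem gammaIntegral_wSeries :
    2 * gammaIntegral wSeries = X * (gammaSeries + 2 * (X * derivative ℂ gammaSeries)) := by
  rw [gammaSeries_eq, ← gaussIntegral_X_sq_mul, ← two_mul_wSeries_subst_uSeries,
    gammaIntegral_apply, two_mul, two_mul, add_mul, map_add]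

/-- `∏_{i = 1}^c (1 + i z)`. -/
def risingSeries (c : ℕ) : PowerSeries ℂ := ∏ i ∈ Finset.range c, (1 + ((i : ℂ) + 1) • X)

theorem risingSeries_succ (c : ℕ) :
    risingSeries (c + 1) = risingSeries c * (1 + ((c : ℂ) + 1) • X) := by
  rw [risingSeries, Finset.prod_range_succ, risingSeries]

/-- Formal counterpart of Γ(c + 1 + 1/z) = Γ(1 + 1/z) ∏(i + 1/z): e^{-w/z} = e^{u/z}(1-u)^{1/z}, so
a factor (1-u)^c shifts the argument of Γ by c. -/
theorem gammaIntegral_one_sub_X_pow (c : ℕ) :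
    gammaIntegral ((1 - X) ^ c) = risingSeries c * gammaSeries := by
  induction c with
  | zero => simp [risingSeries, gammaSeries]
  | succ c ih =>
    have h := gammaIntegral_X_mul ((1 - X) ^ c)
    have h1 : (1 - X) * derivative ℂ ((1 - X : PowerSeries ℂ) ^ c) - (1 - X) ^ c =
        (-((c : ℂ) + 1)) • (1 - X) ^ c := by
      rw [derivative_pow, map_sub, derivative_X, derivative_one, smul_eq_C_mul]
      rcases c with _ | c
      · simp
      · simp [pow_succ]; ring
    have h2 : X * (1 - X : PowerSeries ℂ) ^ c = (1 - X) ^ c - (1 - X) ^ (c + 1) := by ring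
    rw [h1, h2, map_sub, map_smul, ih] at h
    rw [risingSeries_succ]
    rw [smul_eq_C_mul] at h ⊢
    rw [map_neg] at h
    linear_combination -h

/-- Since u = O(v), the factor u^N starts at v^N, while the coefficient of z^k only sees v^{2k}.
This makes infinite sums in u legitimate, one coefficient at a time. -/
theorem coeff_gammaIntegral_X_pow_mul {k N : ℕ} (h : 2 * k < N) (f : PowerSeries ℂ) :
    coeff k (gammaIntegral (X ^ N * f)) = 0 := by
  obtain ⟨q, hq⟩ := X_dvd_iff.mpr constantCoeff_uSeries
  rw [gammaIntegral_apply, coeff_gaussIntegral, subst_mul hasSubst_uSeries,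
    subst_pow hasSubst_uSeries, subst_X hasSubst_uSeries]
  nth_rewrite 1 [hq]
  rw [mul_pow, mul_assoc, mul_assoc, coeff_X_pow_mul', if_neg (by omega), mul_zero]

/-- The average of `f` with respect to `e^{-w(u)/z} du`. -/
def gammaMean : PowerSeries ℂ →ₗ[ℂ] PowerSeries ℂ :=
  (LinearMap.mulRight ℂ gammaSeries⁻¹).comp gammaIntegral

theorem gammaMean_apply (f : PowerSeries ℂ) : gammaMean f = gammaIntegral f * gammaSeries⁻¹ := rfl

theorem gammaSeries_mul_inv : gammaSeries * gammaSeries⁻¹ = 1 :=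
  PowerSeries.mul_inv_cancel _ (by rw [constantCoeff_gammaSeries]; exact one_ne_zero)

theorem gammaIntegral_eq_mean_mul (f : PowerSeries ℂ) :
    gammaIntegral f = gammaMean f * gammaSeries := by
  rw [gammaMean_apply, mul_assoc, mul_comm gammaSeries⁻¹, gammaSeries_mul_inv, mul_one]

theorem gammaMean_one_sub_X_pow (c : ℕ) : gammaMean ((1 - X) ^ c) = risingSeries c := by
  rw [gammaMean_apply, gammaIntegral_one_sub_X_pow, mul_assoc, gammaSeries_mul_inv, mul_one]

theorem coeff_gammaMean_X_pow_mul {k N : ℕ} (h : 2 * k < N) (f : PowerSeries ℂ) :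
    coeff k (gammaMean (X ^ N * f)) = 0 := by
  rw [gammaMean_apply, coeff_mul]
  refine Finset.sum_eq_zero fun p hp => ?_
  have := Finset.HasAntidiagonal.mem_antidiagonal.mp hp
  rw [coeff_gammaIntegral_X_pow_mul (by omega), zero_mul]

theorem coeff_gammaMean (k : ℕ) (f : PowerSeries ℂ) :
    coeff k (gammaMean f) =
      ∑ m ∈ Finset.range (2 * k + 1), coeff m f * coeff k (gammaMean (X ^ m)) := by
  have hf : f = X ^ (2 * k + 1) * (PowerSeries.mk fun i => coeff (i + (2 * k + 1)) f) +
      ∑ m ∈ Finset.range (2 * k + 1), coeff m f • X ^ m := by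
    ext i
    simp only [map_add, coeff_X_pow_mul', coeff_mk, map_sum, map_smul, coeff_X_pow, smul_eq_mul,
      mul_ite, mul_one, mul_zero, Finset.sum_ite_eq, Finset.mem_range]
    split_ifs with h1 h2 h2
    · omega
    · rw [Nat.sub_add_cancel h1, add_zero]
    · rw [zero_add]
    · omega
  nth_rewrite 1 [hf]
  rw [map_add, map_add, coeff_gammaMean_X_pow_mul (by omega), zero_add, map_sum, map_sum]
  simp

/-! ### Interpolation in the exponent -/

theorem coeff_one_sub_X_pow (c m : ℕ) :
    coeff m ((1 - X : PowerSeries ℂ) ^ c) = (-1) ^ m * (c.choose m : ℂ) := by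
  have h : (1 - X : PowerSeries ℂ) ^ c =
      ∑ i ∈ Finset.range (c + 1), ((-1) ^ i * (c.choose i : ℂ)) • X ^ i := by
    rw [sub_eq_add_neg, add_comm, add_pow]
    refine Finset.sum_congr rfl fun i _ => ?_
    rw [neg_pow, smul_eq_C_mul]
    simp
    ring
  rw [h, map_sum]
  simp only [map_smul, coeff_X_pow, smul_eq_mul, mul_ite, mul_one, mul_zero, Finset.sum_ite_eq,
    Finset.mem_range]
  split_ifs with h1
  · rfl
  · rw [Nat.choose_eq_zero_of_lt (by omega)]; simp

/-- The polynomial in `c` whose value at every natural number is the coefficient of `z ^ k` in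
`∏_{i = 1}^c (1 + i z)`. -/
def risingPoly (k : ℕ) : Polynomial ℂ :=
  ∑ m ∈ Finset.range (2 * k + 1),
    Polynomial.C ((-1) ^ m / (m.factorial : ℂ) * coeff k (gammaMean (X ^ m))) * descPochhammer ℂ m

/-- Expanding (1-u)^c binomially shows that the coefficients of the rising product depend
polynomially on c, so that c may be differentiated. -/
theorem eval_risingPoly (k c : ℕ) :
    (risingPoly k).eval (c : ℂ) = coeff k (risingSeries c) := by
  rw [← gammaMean_one_sub_X_pow, coeff_gammaMean, risingPoly, Polynomial.eval_finsetSum]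
  refine Finset.sum_congr rfl fun m _ => ?_
  rw [coeff_one_sub_X_pow, Polynomial.eval_mul, Polynomial.eval_C,
    descPochhammer_eval_eq_descFactorial, Nat.descFactorial_eq_factorial_mul_choose]
  have : (m.factorial : ℂ) ≠ 0 := by exact_mod_cast m.factorial_ne_zero
  push_cast
  field_simp

theorem eval_zero_derivative_descPochhammer (m : ℕ) :
    (Polynomial.derivative (descPochhammer ℂ (m + 1))).eval 0 =
      (-1) ^ m * (m.factorial : ℂ) := by
  induction m with
  | zero => simp
  | succ m ih =>
    rw [descPochhammer_succ_right, Polynomial.derivative_mul, Polynomial.eval_add,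
      Polynomial.eval_mul, Polynomial.eval_mul, ih,
      descPochhammer_ne_zero_eval_zero ℂ (Nat.succ_ne_zero m)]
    simp [Nat.factorial_succ, pow_succ]
    ring

/-- The derivative of (1-u)^c at c = 0 is log(1-u) = -(w+u). -/
theorem derivative_risingPoly_eval_zero (k : ℕ) :
    (Polynomial.derivative (risingPoly k)).eval 0 =
      -coeff k (gammaMean (wSeries + X)) := by
  rw [coeff_gammaMean, risingPoly, Polynomial.derivative_sum, Polynomial.eval_finsetSum,
    ← Finset.sum_neg_distrib]
  refine Finset.sum_congr rfl fun m _ => ?_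
  rw [Polynomial.derivative_C_mul, Polynomial.eval_mul, Polynomial.eval_C]
  rcases m with _ | m
  · simp [wSeries]
  · have hw : coeff (m + 1) (wSeries + X) = 1 / ((m : ℂ) + 1) := by
      rw [map_add, wSeries, coeff_mk, coeff_X]
      rcases m with _ | m <;> simp
    have h1 : (m.factorial : ℂ) ≠ 0 := by exact_mod_cast m.factorial_ne_zero
    have h2 : (m : ℂ) + 1 ≠ 0 := by exact_mod_cast Nat.succ_ne_zero m
    have h3 : ((-1 : ℂ) ^ m) * (-1) ^ m = 1 := by rw [← mul_pow]; simp
    rw [eval_zero_derivative_descPochhammer, hw, Nat.factorial_succ, pow_succ]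
    push_cast
    field_simp
    linear_combination (-coeff k (gammaMean (X ^ (m + 1)))) * h3

/-- The polynomial with values `∑_{i = 1}^c i ^ m`. -/
def powerSumPoly (m : ℕ) : Polynomial ℂ :=
  ∑ i ∈ Finset.range (m + 1),
    Polynomial.C ((bernoulli' i : ℂ) * ((m + 1).choose i : ℂ) / (m + 1)) *
      Polynomial.X ^ (m + 1 - i)

theorem eval_powerSumPoly (m c : ℕ) :
    (powerSumPoly m).eval (c : ℂ) = ∑ i ∈ Finset.range c, ((i : ℂ) + 1) ^ m := by
  have h := congrArg (fun q : ℚ => (q : ℂ)) (sum_Ico_pow c m)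
  push_cast at h
  rw [Finset.sum_Ico_eq_sum_range] at h
  simp only [Nat.add_sub_cancel] at h
  rw [powerSumPoly, Polynomial.eval_finsetSum]
  refine Eq.trans (Finset.sum_congr rfl fun i _ => ?_)
    (h.symm.trans (Finset.sum_congr rfl fun i _ => ?_))
  · simp; ring
  · push_cast; ring

theorem powerSumPoly_eval_zero (m : ℕ) : (powerSumPoly m).eval 0 = 0 := by
  simpa using eval_powerSumPoly m 0

/-- Only the linear term of Faulhaber's formula, the one with i = m, survives. -/
theorem derivative_powerSumPoly_eval_zero (m : ℕ) :
    (Polynomial.derivative (powerSumPoly m)).eval 0 = (bernoulli' m : ℂ) := by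
  rw [powerSumPoly, Polynomial.derivative_sum, Polynomial.eval_finsetSum,
    Finset.sum_range_succ, Finset.sum_eq_zero, zero_add]
  · have h2 : (m : ℂ) + 1 ≠ 0 := by exact_mod_cast Nat.succ_ne_zero m
    simp
    field_simp
  · intro i hi
    have : m + 1 - i = (m - i - 1) + 1 + 1 := by
      have := Finset.mem_range.mp hi
      omega
    rw [this]
    simp

/-- `∑_{i = 1}^c i z / (1 + i z)`. -/
def logDerivSeries (c : ℕ) : PowerSeries ℂ :=
  PowerSeries.mk fun m => if m = 0 then 0 else
    -(-1) ^ m * ∑ i ∈ Finset.range c, ((i : ℂ) + 1) ^ m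

theorem X_mul_derivative_risingSeries (c : ℕ) :
    X * derivative ℂ (risingSeries c) = logDerivSeries c * risingSeries c := by
  induction c with
  | zero =>
    have : logDerivSeries 0 = 0 := by ext m; simp [logDerivSeries]
    rw [this]; simp [risingSeries]
  | succ c ih =>
    set a : ℂ := (c : ℂ) + 1 with ha
    set ρ : PowerSeries ℂ := PowerSeries.mk fun m => if m = 0 then 0 else -(-a) ^ m with hρ
    have h1 : logDerivSeries (c + 1) = logDerivSeries c + ρ := by
      ext m
      rw [map_add, logDerivSeries, logDerivSeries, hρ, coeff_mk, coeff_mk, coeff_mk]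
      split_ifs
      · simp
      · rw [Finset.sum_range_succ, ← ha, neg_pow a]; ring
    have h2 : (1 + a • X) * ρ = a • X := by
      ext m
      rw [add_mul, one_mul, smul_mul_assoc, map_add, map_smul, map_smul]
      rcases m with _ | _ | m
      · simp [hρ]
      · rw [coeff_succ_X_mul]; simp [hρ]
      · rw [coeff_succ_X_mul, coeff_X]; simp [hρ]; ring
    have h3 : derivative ℂ (1 + a • X : PowerSeries ℂ) = C a := by
      rw [map_add, Derivation.map_smul, derivative_one, derivative_X, smul_eq_C_mul]; simp
    rw [risingSeries_succ, ← ha, Derivation.leibniz, h3, h1]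
    rw [smul_eq_C_mul] at h2 ⊢
    simp only [smul_eq_mul]
    linear_combination (1 + C a * X) * ih - risingSeries c * h2

theorem polynomial_eq_of_eval_nat {p q : Polynomial ℂ}
    (h : ∀ c : ℕ, p.eval (c : ℂ) = q.eval (c : ℂ)) : p = q := by
  refine Polynomial.eq_of_infinite_eval_eq p q (Set.Infinite.mono ?_
    (Set.infinite_range_of_injective (Nat.cast_injective (R := ℂ))))
  rintro _ ⟨c, rfl⟩
  exact h c

/-- Newton's identities for 1, …, c, promoted from natural c to an identity of polynomials in c. -/
theorem risingPoly_newton (k : ℕ) :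
    Polynomial.C (k : ℂ) * risingPoly k = ∑ p ∈ Finset.HasAntidiagonal.antidiagonal k,
      (if p.1 = 0 then 0 else Polynomial.C (-(-1) ^ p.1) * powerSumPoly p.1) *
        risingPoly p.2 := by
  refine polynomial_eq_of_eval_nat fun c => ?_
  have h := congrArg (coeff k) (X_mul_derivative_risingSeries c)
  have hl : coeff k (X * derivative ℂ (risingSeries c)) = k * coeff k (risingSeries c) := by
    rcases k with _ | k
    · simp
    · rw [coeff_succ_X_mul, coeff_derivative]; push_cast; ring
  rw [hl, coeff_mul] at h
  rw [Polynomial.eval_mul, Polynomial.eval_C, eval_risingPoly, h, Polynomial.eval_finsetSum]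
  refine Finset.sum_congr rfl fun p _ => ?_
  rw [Polynomial.eval_mul, eval_risingPoly, logDerivSeries, coeff_mk]
  split_ifs
  · simp
  · rw [Polynomial.eval_mul, Polynomial.eval_C, eval_powerSumPoly]

theorem coeff_gammaMean_log (k : ℕ) :
    (k : ℂ) * coeff k (gammaMean (wSeries + X)) =
      if k = 0 then 0 else (-1) ^ k * (bernoulli' k : ℂ) := by
  have h := congrArg (fun p => (Polynomial.derivative p).eval 0) (risingPoly_newton k)
  simp only [Polynomial.derivative_sum, Polynomial.eval_finsetSum] at h
  rw [Polynomial.derivative_C_mul, Polynomial.eval_mul, Polynomial.eval_C,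
    derivative_risingPoly_eval_zero] at h
  have h0 : ∀ j, (risingPoly j).eval 0 = if j = 0 then 1 else 0 := fun j => by
    have := eval_risingPoly j 0
    rw [Nat.cast_zero] at this
    rw [this, risingSeries, Finset.range_zero, Finset.prod_empty, coeff_one]
  -- By the product rule at c = 0, where all power sums vanish and the rising product is 1, only the
  -- pair (k, 0) can contribute.
  have hterm : ∀ p ∈ Finset.HasAntidiagonal.antidiagonal k,
      (Polynomial.derivative ((if p.1 = 0 then 0 else
        Polynomial.C (-(-1 : ℂ) ^ p.1) * powerSumPoly p.1) * risingPoly p.2)).eval 0 =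
      if p = (k, 0) then (if k = 0 then 0 else -((-1) ^ k * (bernoulli' k : ℂ))) else 0 := by
    rintro ⟨i, j⟩ hp
    have hij : i + j = k := Finset.HasAntidiagonal.mem_antidiagonal.mp hp
    simp only [Prod.mk.injEq]
    by_cases hi : i = 0
    · subst hi
      by_cases hj : j = 0
      · subst hj; simp [← hij]
      · simp [hj]
    · rw [if_neg hi, Polynomial.derivative_mul, Polynomial.derivative_C_mul]
      simp only [Polynomial.eval_add, Polynomial.eval_mul, Polynomial.eval_C,
        powerSumPoly_eval_zero, derivative_powerSumPoly_eval_zero, h0]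
      by_cases hj : j = 0
      · subst hj
        rw [add_zero] at hij
        subst hij
        simp [hi]
      · simp [hj]
  rw [Finset.sum_congr rfl hterm, Finset.sum_ite_eq', if_pos (by simp)] at h
  split_ifs at h ⊢ with hk <;> linear_combination -h

/-! ### The Stirling series -/

/-- The term z/2 cancels the contribution -z/2 of B₁; the remaining odd Bernoulli numbers vanish. -/
theorem derivative_stirlingExponent_mul_sq :
    gammaMean (wSeries + X) + C (1 / 2) * X = -(X ^ 2 * derivative ℂ stirlingExponent) := by
  ext k
  rw [map_add, map_neg, coeff_C_mul, coeff_X, coeff_X_pow_mul']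
  have h := coeff_gammaMean_log k
  rcases k with _ | _ | k
  · rw [coeff_gammaMean]; simp [wSeries]
  · rw [zero_add, Nat.cast_one, one_mul, if_neg one_ne_zero, bernoulli'_one] at h
    rw [zero_add, h]; norm_num
  · rw [if_neg (by omega), if_pos (by omega),
      show k + 1 + 1 - 2 = k by omega, coeff_derivative,
      stirlingExponent, coeff_mk]
    have h1 : ((k : ℂ) + 1 + 1) ≠ 0 := by exact_mod_cast Nat.succ_ne_zero (k + 1)
    have h2 : ((k : ℂ) + 1) ≠ 0 := by exact_mod_cast Nat.succ_ne_zero k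
    rw [if_neg (by omega), ← bernoulli_eq_bernoulli'_of_ne_one (by omega)] at h
    push_cast at h ⊢
    apply mul_left_cancel₀ h1
    rcases Nat.even_or_odd k with hk | hk
    · rw [if_pos hk.add_one]
      have h3 : (-1 : ℂ) ^ (k + 1 + 1) = 1 := hk.add_one.add_one.neg_one_pow
      rw [h3] at h
      rw [mul_add, h]
      field_simp
      ring
    · rw [if_neg (by simpa using hk.add_one)]
      have h3 : bernoulli (k + 1 + 1) = 0 := by
        rw [bernoulli_eq_bernoulli'_of_ne_one (by omega)]
        exact bernoulli'_eq_zero_of_odd (by simpa using hk.add_one.add_one) (by omega)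
      rw [h3] at h
      simp at h ⊢
      exact h

/-- Combine the two values of the integral of w: the z-derivative rule, and the average of w + u
together with the integral -zΓ of u, where Γ is `gammaSeries`. The result is z²Γ' = (average + z/2)
Γ. -/
theorem derivative_gammaSeries :
    derivative ℂ gammaSeries = -derivative ℂ stirlingExponent * gammaSeries := by
  have h1 := gammaIntegral_wSeries
  have h2 := gammaIntegral_eq_mean_mul (wSeries + X)
  rw [map_add, gammaIntegral_X] at h2
  have h3 := derivative_stirlingExponent_mul_sq
  have h4 : (2 : PowerSeries ℂ) * C (1 / 2) = 1 := by
    rw [← map_ofNat (C (R := ℂ)) 2, ← map_mul]; norm_num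
  have h5 : (2 : PowerSeries ℂ) * X ^ 2 ≠ 0 := by
    refine mul_ne_zero ?_ (pow_ne_zero 2 X_ne_zero)
    rw [← map_ofNat (C (R := ℂ)) 2, Ne, map_eq_zero_iff _ C_injective]
    exact two_ne_zero
  apply mul_left_cancel₀ h5
  linear_combination -h1 + 2 * h2 + 2 * gammaSeries * h3 - X * gammaSeries * h4

theorem eq_of_derivative_eq_mul {a f g : PowerSeries ℂ} (hf : derivative ℂ f = a * f)
    (hg : derivative ℂ g = a * g) (h0 : constantCoeff f = constantCoeff g) : f = g := by
  ext k
  induction k using Nat.strong_induction_on with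
  | _ k ih =>
    rcases k with _ | k
    · simpa using h0
    · have h1 : coeff k (derivative ℂ f) = coeff k (derivative ℂ g) := by
        rw [hf, hg, coeff_mul, coeff_mul]
        refine Finset.sum_congr rfl fun p hp => ?_
        have := Finset.HasAntidiagonal.mem_antidiagonal.mp hp
        rw [ih p.2 (by omega)]
      rw [coeff_derivative, coeff_derivative] at h1
      exact mul_right_cancel₀ (by exact_mod_cast Nat.succ_ne_zero k) h1

/-- The generating series of the Stirling coefficients. -/
def stirlingSeries : PowerSeries ℂ := (exp ℂ).subst stirlingExponent

theorem constantCoeff_stirlingExponent : constantCoeff stirlingExponent = 0 := by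
  rw [← coeff_zero_eq_constantCoeff_apply, stirlingExponent, coeff_mk]; simp

theorem stirlingCoeff_eq (k : ℕ) : stirlingCoeff k = coeff k stirlingSeries := rfl

theorem stirlingCoeff_zero : stirlingCoeff 0 = 1 := by
  have hs := HasSubst.of_constantCoeff_zero' constantCoeff_stirlingExponent
  have h : (exp ℂ - 1).subst stirlingExponent = stirlingSeries - 1 := by
    rw [subst_sub hs, one_subst hs, stirlingSeries]
  have h1 : constantCoeff ((exp ℂ - 1).subst stirlingExponent : PowerSeries ℂ) = 0 :=
    constantCoeff_subst_eq_zero constantCoeff_stirlingExponent _ (by simp)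
  rw [h, map_sub, map_one, sub_eq_zero] at h1
  rw [stirlingCoeff_eq, coeff_zero_eq_constantCoeff_apply, h1]

theorem derivative_stirlingSeries :
    derivative ℂ stirlingSeries = derivative ℂ stirlingExponent * stirlingSeries := by
  have hs := HasSubst.of_constantCoeff_zero' constantCoeff_stirlingExponent
  rw [stirlingSeries, derivative_subst hs]
  have : derivative ℂ (exp ℂ) = exp ℂ := by
    ext k
    rw [coeff_derivative, coeff_exp, coeff_exp]
    have h2 : ((k : ℂ) + 1) ≠ 0 := by exact_mod_cast Nat.succ_ne_zero k
    have h1 : (k.factorial : ℂ) ≠ 0 := by exact_mod_cast k.factorial_ne_zero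
    simp [Nat.factorial_succ]
    field_simp
  rw [this, mul_comm]

theorem derivative_rescale_neg_one (f : PowerSeries ℂ) :
    derivative ℂ (rescale (-1 : ℂ) f) = -rescale (-1 : ℂ) (derivative ℂ f) := by
  ext k
  rw [coeff_derivative, map_neg, coeff_rescale, coeff_rescale, coeff_derivative, pow_succ]
  ring

/-- The Stirling exponent is odd, so z ↦ -z inverts its exponential; both sides then solve the same
first-order linear equation with constant term 1. -/
theorem gammaSeries_eq_rescale : gammaSeries = rescale (-1 : ℂ) stirlingSeries := by
  refine eq_of_derivative_eq_mul derivative_gammaSeries ?_ ?_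
  · rw [derivative_rescale_neg_one, derivative_stirlingSeries, map_mul, neg_mul]
    congr 2
    ext k
    rw [coeff_rescale, coeff_derivative, stirlingExponent, coeff_mk]
    split_ifs with h
    · rw [(show Even k by rcases h with ⟨j, hj⟩; exact ⟨j, by omega⟩).neg_one_pow, one_mul]
    · simp
  · rw [constantCoeff_gammaSeries, ← coeff_zero_eq_constantCoeff_apply, coeff_rescale,
      ← stirlingCoeff_eq, stirlingCoeff_zero]
    simp

/-- The odd coefficients of `u(v)` are given by the Stirling coefficients. -/
theorem coeff_uSeries_odd (k : ℕ) :
    oddFactorial (k + 1) * coeff (2 * k + 1) uSeries = (-1) ^ k * stirlingCoeff k := by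
  rw [← coeff_gammaSeries, gammaSeries_eq_rescale, coeff_rescale, stirlingCoeff_eq]

/-! ### Calculus of Laurent series at `t = ∞` -/

/-- A power series in `1/t` as a Laurent series. -/
abbrev ofPS : PowerSeries ℂ →+* LaurentSeries ℂ := HahnSeries.ofPowerSeries ℤ ℂ

theorem coeff_ddt (f : LaurentSeries ℂ) (n : ℤ) :
    (ddt f).coeff n = -(((n - 1 : ℤ) : ℂ) * f.coeff (n - 1)) := by
  rw [ddt, HahnSeries.coeff_neg, HahnSeries.coeff_single_mul, one_mul,
    LaurentSeries.derivative_apply, LaurentSeries.hasseDeriv_coeff]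
  have h : n - 2 + ((1 : ℕ) : ℤ) = n - 1 := by push_cast; ring
  rw [h, Ring.choose_one_right, zsmul_eq_mul]

theorem ddt_mul (f g : LaurentSeries ℂ) : ddt (f * g) = f * ddt g + g * ddt f := by
  -- `θ` is the Euler operator, written with the support of its argument
  set θ : LaurentSeries ℂ → LaurentSeries ℂ := fun f =>
    ⟨fun n => (n : ℂ) * f.coeff n, f.isPWO_support.mono fun n hn h0 => hn (by simp [h0])⟩ with hθ
  have hsupp : ∀ f, (θ f).support ⊆ f.support := fun f n hn h0 => hn (by simp [hθ, h0])
  have hddt : ∀ f, ddt f = -(HahnSeries.single 1 1 * θ f) := fun f => by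
    ext n
    rw [coeff_ddt, HahnSeries.coeff_neg, HahnSeries.coeff_single_mul, one_mul]
  have hleib : θ (f * g) = f * θ g + g * θ f := by
    ext n
    rw [HahnSeries.coeff_add, mul_comm g,
      HahnSeries.coeff_mul_right' g.isPWO_support (hsupp g),
      HahnSeries.coeff_mul_left' f.isPWO_support (hsupp f), ← Finset.sum_add_distrib]
    change (n : ℂ) * (f * g).coeff n = _
    rw [HahnSeries.coeff_mul, Finset.mul_sum]
    refine Finset.sum_congr rfl fun p hp => ?_
    have hp' : p.1 + p.2 = n := by simpa using (Finset.mem_antidiagonal.mp hp).2.2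
    rw [← hp']
    change _ = f.coeff p.1 * ((p.2 : ℂ) * g.coeff p.2) + ((p.1 : ℂ) * f.coeff p.1) * g.coeff p.2
    push_cast
    ring
  rw [hddt, hddt, hddt, hleib]
  ring

theorem algebraMap_laurentSeries (c : ℂ) :
    algebraMap ℂ (LaurentSeries ℂ) c = HahnSeries.C c := by
  rw [HahnSeries.algebraMap_apply']
  exact HahnSeries.ofPowerSeries_C c

/-- `d/dt` as a derivation of the field of Laurent series. -/
def ddtDerivation : Derivation ℂ (LaurentSeries ℂ) (LaurentSeries ℂ) :=
  Derivation.mk' (@LinearMap.mk ℂ ℂ _ _ (RingHom.id ℂ) (LaurentSeries ℂ) (LaurentSeries ℂ) _ _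
      Algebra.toModule _
      ⟨ddt, fun f g => by ext n; simp only [coeff_ddt, HahnSeries.coeff_add]; ring⟩
      fun c f => by
        ext n
        simp only [coeff_ddt, Algebra.smul_def, algebraMap_laurentSeries, HahnSeries.C_mul_eq_smul,
          HahnSeries.coeff_smul, RingHom.id_apply]
        ring)
    (fun f g => ddt_mul f g)

theorem ddtDerivation_apply (f : LaurentSeries ℂ) : ddtDerivation f = ddt f := rfl

theorem ddt_zpow (f : LaurentSeries ℂ) (n : ℤ) :
    ddt (f ^ n) = (n : LaurentSeries ℂ) * (f ^ (n - 1) * ddt f) := by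
  have := ddtDerivation.leibniz_zpow f n
  simpa [ddtDerivation_apply] using this

theorem ddt_inv (f : LaurentSeries ℂ) : ddt f⁻¹ = -(f⁻¹ ^ 2 * ddt f) := by
  have := ddtDerivation.leibniz_inv f
  rw [ddtDerivation_apply, ddtDerivation_apply, smul_eq_mul] at this
  rw [this]
  ring

theorem ddt_add (f g : LaurentSeries ℂ) : ddt (f + g) = ddt f + ddt g :=
  map_add ddtDerivation f g

theorem ddt_sub (f g : LaurentSeries ℂ) : ddt (f - g) = ddt f - ddt g :=
  map_sub ddtDerivation f g

theorem ddt_neg (f : LaurentSeries ℂ) : ddt (-f) = -ddt f :=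
  map_neg ddtDerivation f

theorem coeff_one_ddt (f : LaurentSeries ℂ) : (ddt f).coeff 1 = 0 := by
  rw [coeff_ddt]; simp

theorem ofPS_X : ofPS X = HahnSeries.single 1 1 := HahnSeries.ofPowerSeries_X

theorem ofPS_coeff_nat (p : PowerSeries ℂ) (n : ℕ) : (ofPS p).coeff n = coeff n p :=
  HahnSeries.ofPowerSeries_apply_coeff p n

theorem ofPS_coeff_neg (p : PowerSeries ℂ) {n : ℤ} (hn : n < 0) : (ofPS p).coeff n = 0 := by
  have := PowerSeries.coeff_coe p n
  rwa [if_pos hn] at this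

theorem ddt_ofPS (p : PowerSeries ℂ) : ddt (ofPS p) = -ofPS (X ^ 2 * derivative ℂ p) := by
  ext n
  rw [coeff_ddt, HahnSeries.coeff_neg]
  congr 1
  rw [map_mul, map_pow, ofPS_X, HahnSeries.single_pow, HahnSeries.coeff_single_mul]
  simp only [one_pow, one_mul, nsmul_eq_mul, mul_one, Nat.cast_ofNat]
  rcases lt_trichotomy n 1 with h | h | h
  · rw [ofPS_coeff_neg _ (by omega), ofPS_coeff_neg _ (by omega), mul_zero]
  · subst h
    rw [ofPS_coeff_neg _ (show (1 : ℤ) - 2 < 0 by norm_num)]; simp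
  · obtain ⟨m, rfl⟩ : ∃ m : ℕ, n = m + 2 := ⟨(n - 2).toNat, by omega⟩
    rw [show (m : ℤ) + 2 - 1 = ((m + 1 : ℕ) : ℤ) by push_cast; ring,
      show (m : ℤ) + 2 - 2 = (m : ℤ) by ring,
      ofPS_coeff_nat, ofPS_coeff_nat, coeff_derivative]
    push_cast
    ring

theorem ddt_ofPS_subst (p : PowerSeries ℂ) {g : PowerSeries ℂ} (hg : HasSubst g) :
    ddt (ofPS (p.subst g)) = ofPS ((derivative ℂ p).subst g) * ddt (ofPS g) := by
  have h : X ^ 2 * derivative ℂ (p.subst g : PowerSeries ℂ) =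
      (derivative ℂ p).subst g * (X ^ 2 * derivative ℂ g) := by
    rw [derivative_subst hg]; ring
  rw [ddt_ofPS, ddt_ofPS, h, map_mul]
  ring

/-! ### Orders of vanishing -/

theorem le_orderTop_iff {f : LaurentSeries ℂ} {n : ℤ} :
    (n : WithTop ℤ) ≤ f.orderTop ↔ ∀ i < n, f.coeff i = 0 := by
  rw [HahnSeries.le_orderTop_iff_forall]
  simp only [WithTop.coe_lt_coe]

theorem le_orderTop_mul {f g : LaurentSeries ℂ} {m n : ℤ} (hf : (m : WithTop ℤ) ≤ f.orderTop)
    (hg : (n : WithTop ℤ) ≤ g.orderTop) : ((m + n : ℤ) : WithTop ℤ) ≤ (f * g).orderTop := by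
  rw [WithTop.coe_add]
  exact (add_le_add hf hg).trans HahnSeries.orderTop_add_le_mul

theorem le_orderTop_add {f g : LaurentSeries ℂ} {n : ℤ} (hf : (n : WithTop ℤ) ≤ f.orderTop)
    (hg : (n : WithTop ℤ) ≤ g.orderTop) : (n : WithTop ℤ) ≤ (f + g).orderTop :=
  (le_min hf hg).trans HahnSeries.min_orderTop_le_orderTop_add

theorem le_orderTop_ofPS (p : PowerSeries ℂ) : ((0 : ℤ) : WithTop ℤ) ≤ (ofPS p).orderTop :=
  le_orderTop_iff.mpr fun _ hi => ofPS_coeff_neg p hi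

theorem le_orderTop_ofPS_X_pow_mul (n : ℕ) (p : PowerSeries ℂ) :
    ((n : ℤ) : WithTop ℤ) ≤ (ofPS (X ^ n * p)).orderTop := by
  refine le_orderTop_iff.mpr fun i hi => ?_
  rcases lt_or_ge i 0 with h | h
  · exact ofPS_coeff_neg _ h
  · obtain ⟨m, rfl⟩ := Int.eq_ofNat_of_zero_le h
    rw [ofPS_coeff_nat, coeff_X_pow_mul', if_neg (by omega)]

theorem le_orderTop_ddt {f : LaurentSeries ℂ} {n : ℤ} (hf : (n : WithTop ℤ) ≤ f.orderTop) :
    ((n + 1 : ℤ) : WithTop ℤ) ≤ (ddt f).orderTop := by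
  rw [le_orderTop_iff] at hf ⊢
  intro i hi
  rw [coeff_ddt, hf _ (by omega), mul_zero, neg_zero]

/-! ### The coordinate `v` and residues -/

theorem vL_eq : vL = ofPS vSeries := rfl

theorem exists_vSeries_eq : ∃ y : PowerSeries ℂ, vSeries = X * y ∧ constantCoeff y = 1 := by
  obtain ⟨y, hy⟩ := X_dvd_iff.mpr vSeries_spec.1
  refine ⟨y, hy, ?_⟩
  have := vSeries_spec.2.1
  rw [hy, show (1 : ℕ) = 0 + 1 from rfl, coeff_succ_X_mul] at this
  simpa using this

theorem vSeries_ne_zero : vSeries ≠ 0 := fun h => by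
  have := vSeries_spec.2.1
  rw [h] at this
  simp at this

theorem ofPS_ne_zero {p : PowerSeries ℂ} (hp : p ≠ 0) : ofPS p ≠ 0 :=
  (map_ne_zero_iff _ HahnSeries.ofPowerSeries_injective).mpr hp

theorem vL_ne_zero : vL ≠ 0 := ofPS_ne_zero vSeries_ne_zero

/-- The residue of dv/v. The sign is that of dt/t, since v behaves like 1/t. -/
theorem coeff_one_inv_vL_mul_ddt : (vL⁻¹ * ddt vL).coeff 1 = -1 := by
  obtain ⟨y, hy, hy0⟩ := exists_vSeries_eq
  have h1 : vL⁻¹ * ddt vL = ofPS (-(X * (1 + X * (y⁻¹ * derivative ℂ y)))) := by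
    rw [inv_mul_eq_iff_eq_mul₀ vL_ne_zero, vL_eq, ddt_ofPS, ← map_mul, ← map_neg, hy,
      Derivation.leibniz, derivative_X]
    congr 1
    have : y * y⁻¹ = 1 := PowerSeries.mul_inv_cancel _ (by rw [hy0]; exact one_ne_zero)
    simp only [smul_eq_mul]
    linear_combination X ^ 3 * derivative ℂ y * this
  rw [h1, show (1 : ℤ) = ((0 + 1 : ℕ) : ℤ) by norm_num, ofPS_coeff_nat, map_neg, coeff_succ_X_mul]
  simp

theorem exists_principal_part (C : PowerSeries ℂ) (N : ℕ) : ∃ R : PowerSeries ℂ,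
    vL ^ (-(N : ℤ)) * ofPS (C.subst vSeries) =
      ∑ i ∈ Finset.range N, HahnSeries.C (coeff i C) * vL ^ ((i : ℤ) - N) +
        ofPS (R.subst vSeries) := by
  set R : PowerSeries ℂ := PowerSeries.mk fun i => coeff (i + N) C with hR
  have hC : C = ∑ i ∈ Finset.range N, coeff i C • X ^ i + X ^ N * R := by
    ext i
    simp only [map_add, coeff_X_pow_mul', map_sum, map_smul, coeff_X_pow, smul_eq_mul,
      mul_ite, mul_one, mul_zero, Finset.sum_ite_eq, Finset.mem_range, hR, coeff_mk]
    split_ifs with h1 h2 h2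
    · omega
    · rw [add_zero]
    · rw [Nat.sub_add_cancel h2, zero_add]
    · omega
  refine ⟨R, ?_⟩
  have hv := hasSubst_vSeries
  nth_rewrite 1 [hC]
  rw [subst_add hv, subst_mul hv, subst_pow hv, subst_X hv, ← coe_substAlgHom hv, map_sum,
    map_add, map_sum, mul_add, Finset.mul_sum]
  congr 1
  · refine Finset.sum_congr rfl fun i _ => ?_
    rw [map_smul, map_pow, substAlgHom_X, smul_eq_C_mul, map_mul, map_pow,
      HahnSeries.ofPowerSeries_C, ← vL_eq, mul_left_comm, sub_eq_add_neg,
      zpow_add₀ vL_ne_zero, zpow_natCast, mul_comm (vL ^ i)]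
  · rw [map_mul, map_pow, ← vL_eq, ← mul_assoc, ← zpow_natCast vL N, ← zpow_add₀ vL_ne_zero,
      neg_add_cancel, zpow_zero, one_mul]

/-- Invariance of the residue under the change of coordinate `u ↦ v`. -/
theorem residue_vL (C : PowerSeries ℂ) (r : ℕ) :
    (vL ^ (-((r + 1 : ℕ) : ℤ)) * ofPS (C.subst vSeries) * ddt vL).coeff 1 = -coeff r C := by
  obtain ⟨R, hR⟩ := exists_principal_part C (r + 1)
  rw [hR, add_mul, HahnSeries.coeff_add, Finset.sum_mul, HahnSeries.coeff_sum,
    Finset.sum_range_succ, Finset.sum_eq_zero, zero_add]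
  · have h1 : (ofPS (R.subst vSeries) * ddt vL).coeff 1 = 0 := by
      have h : ofPS (R.subst vSeries) * ddt vL =
          ofPS (X ^ 2 * -(R.subst vSeries * derivative ℂ vSeries)) := by
        rw [vL_eq, ddt_ofPS, ← map_neg, ← map_mul]
        congr 1
        ring
      rw [h, show (1 : ℤ) = ((1 : ℕ) : ℤ) by norm_num, ofPS_coeff_nat, coeff_X_pow_mul',
        if_neg (by norm_num)]
    rw [h1, add_zero, mul_assoc, show ((r : ℕ) : ℤ) - ((r + 1 : ℕ) : ℤ) = -1 by push_cast; ring,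
      zpow_neg_one, HahnSeries.C_mul_eq_smul, HahnSeries.coeff_smul, coeff_one_inv_vL_mul_ddt]
    simp
  · intro i hi
    have hi' := Finset.mem_range.mp hi
    -- For an exponent other than -1, the power of v times dv is exact, and a t-derivative has no
    -- t^{-1} term.
    have h2 := coeff_one_ddt (vL ^ ((i : ℤ) - r))
    have h3 : (((i : ℤ) - r : ℤ) : ℂ) ≠ 0 := by
      rw [Int.cast_ne_zero]; omega
    have h4 : (((i : ℤ) - r : ℤ) : LaurentSeries ℂ) = HahnSeries.C (((i : ℤ) - r : ℤ) : ℂ) :=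
      (map_intCast _ _).symm
    rw [ddt_zpow, h4, HahnSeries.C_mul_eq_smul, HahnSeries.coeff_smul, smul_eq_mul,
      mul_eq_zero, or_iff_right h3] at h2
    rw [mul_assoc, HahnSeries.C_mul_eq_smul, HahnSeries.coeff_smul,
      show (i : ℤ) - ((r + 1 : ℕ) : ℤ) = (i : ℤ) - r - 1 by push_cast; ring, h2, smul_zero]

/-! ### The series `η_n(v(t))` -/

theorem oddDoubleFactorial_neg (k : ℕ) :
    oddDoubleFactorial (-1 - (k : ℤ)) = (-1) ^ (k + 1) / oddFactorial (k + 1) := by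
  have : -1 - (k : ℤ) = Int.negSucc k := by omega
  rw [this]
  rfl

theorem oddDoubleFactorial_ne_zero (m : ℤ) : oddDoubleFactorial m ≠ 0 := by
  rcases m with m | j
  · exact oddFactorial_ne_zero m
  · exact div_ne_zero (pow_ne_zero _ (by norm_num)) (oddFactorial_ne_zero (j + 1))

/-- The even power series `v ^ (2n + 1) η_n(v)`. -/
def etaSeries (n : ℤ) : PowerSeries ℂ :=
  PowerSeries.mk fun j =>
    if Even j then stirlingCoeff (j / 2) * oddDoubleFactorial (n - (j / 2 : ℕ)) else 0

theorem eta_eq (n : ℤ) :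
    eta n = HahnSeries.single (-(2 * n + 1)) (1 : ℂ) * ofPS (etaSeries n) := rfl

theorem constantCoeff_etaSeries (n : ℤ) :
    constantCoeff (etaSeries n) = oddDoubleFactorial n := by
  rw [← coeff_zero_eq_constantCoeff_apply, etaSeries, coeff_mk]
  simp [stirlingCoeff_zero]

theorem coeff_etaSeries_odd (n : ℤ) {j : ℕ} (hj : ¬ Even j) : coeff j (etaSeries n) = 0 := by
  rw [etaSeries, coeff_mk, if_neg hj]

/-- The nonzero constant term pins the order to a, so the factorization used by `laurentSubst` is
the displayed one. -/
theorem laurentSubst_single_mul (a : ℤ) {p : PowerSeries ℂ} (hp : constantCoeff p ≠ 0)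
    (g : PowerSeries ℂ) :
    laurentSubst (HahnSeries.single a (1 : ℂ) * ofPS p) g = ofPS g ^ a * ofPS (p.subst g) := by
  set f : LaurentSeries ℂ := HahnSeries.single a (1 : ℂ) * ofPS p with hf
  have hco : ∀ n : ℤ, f.coeff n = (ofPS p).coeff (n - a) := fun n => by
    rw [hf, HahnSeries.coeff_single_mul, one_mul]
  have h0 : f.coeff a ≠ 0 := by
    rw [hco, sub_self, show (0 : ℤ) = ((0 : ℕ) : ℤ) from rfl, ofPS_coeff_nat,
      coeff_zero_eq_constantCoeff_apply]
    exact hp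
  have hord : f.order = a := by
    refine le_antisymm (HahnSeries.order_le_of_coeff_ne_zero h0) ?_
    by_contra! h
    have h1 : f ≠ 0 := fun h1 => h0 (by rw [h1, HahnSeries.coeff_zero])
    apply HahnSeries.coeff_order_eq_zero.not.mpr h1
    rw [hco, ofPS_coeff_neg _ (by omega)]
  have hpart : f.powerSeriesPart = p := by
    ext n
    rw [LaurentSeries.powerSeriesPart_coeff, hord, hco, add_sub_cancel_left, ofPS_coeff_nat]
  rw [laurentSubst, hord, hpart]

theorem etaL_eq (n : ℤ) :
    etaL n = vL ^ (-(2 * n + 1)) * ofPS ((etaSeries n).subst vSeries) := by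
  rw [etaL, eta_eq, laurentSubst_single_mul _ _ vSeries, vL_eq]
  rw [constantCoeff_etaSeries]
  exact oddDoubleFactorial_ne_zero n

theorem X_mul_derivative_etaSeries (n : ℤ) :
    X * derivative ℂ (etaSeries n) - C ((2 * n + 1 : ℤ) : ℂ) * etaSeries n =
      -etaSeries (n + 1) := by
  ext j
  have h1 : coeff j (X * derivative ℂ (etaSeries n)) = j * coeff j (etaSeries n) := by
    rcases j with _ | j
    · simp
    · rw [coeff_succ_X_mul, coeff_derivative]; push_cast; ring
  rw [map_sub, h1, coeff_C_mul, map_neg, etaSeries, etaSeries, coeff_mk, coeff_mk]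
  split_ifs with h
  · obtain ⟨k, rfl⟩ := h
    have h2 : (k + k) / 2 = k := by omega
    rw [h2, show n + 1 - (k : ℤ) = n - k + 1 by ring, oddDoubleFactorial_succ]
    push_cast
    ring
  · simp

/-- `dw/dt`, in the coordinate `v`. -/
def wDeriv : LaurentSeries ℂ := vL * ddt vL

/-- -d/dw = -v^{-1} d/dv raises the index, by the recursion of the double factorials. -/
theorem ddt_etaL (n : ℤ) : ddt (etaL n) = -(wDeriv * etaL (n + 1)) := by
  have h := congrArg (fun f : PowerSeries ℂ => ofPS (f.subst vSeries))
    (X_mul_derivative_etaSeries n)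
  have hv := hasSubst_vSeries
  have hneg : (-etaSeries (n + 1)).subst vSeries = -((etaSeries (n + 1)).subst vSeries) := by
    rw [← coe_substAlgHom hv, map_neg]
  have hC : (C ((2 * n + 1 : ℤ) : ℂ)).subst vSeries = (C ((2 * n + 1 : ℤ) : ℂ) : PowerSeries ℂ) :=
    subst_C _
  simp only [hneg, subst_sub hv, subst_mul hv, subst_X hv, hC, map_sub, map_mul, map_neg] at h
  rw [map_intCast, map_intCast, ← vL_eq] at h
  rw [etaL_eq, etaL_eq, ddt_mul, ddt_zpow, ddt_ofPS_subst _ hv, wDeriv, ← vL_eq]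
  have e1 : vL ^ (-(2 * n + 1)) = vL ^ (-(2 * (n + 1) + 1)) * vL * vL := by
    rw [← zpow_add_one₀ vL_ne_zero, ← zpow_add_one₀ vL_ne_zero]; congr 1; ring
  have e2 : vL ^ (-(2 * n + 1) - 1) = vL ^ (-(2 * (n + 1) + 1)) * vL := by
    rw [← zpow_add_one₀ vL_ne_zero]; congr 1; ring
  rw [e1, e2]
  push_cast at h ⊢
  linear_combination (vL ^ (-(2 * ((n : ℤ) + 1) + 1)) * vL * ddt vL) * h

/-! ### The deck transformation -/

theorem two_ne_zero_powerSeries : (2 : PowerSeries ℂ) ≠ 0 := by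
  rw [← map_ofNat (C (R := ℂ)) 2, Ne, map_eq_zero_iff _ C_injective]
  exact two_ne_zero

theorem two_ne_zero_laurentSeries : (2 : LaurentSeries ℂ) ≠ 0 := by
  rw [← map_ofNat ofPS 2]
  exact ofPS_ne_zero two_ne_zero_powerSeries

theorem uSeries_subst_vSeries_subst {σ : PowerSeries ℂ} (hσ : constantCoeff σ = 0) :
    uSeries.subst (vSeries.subst σ : PowerSeries ℂ) = σ := by
  have hs : HasSubst σ := HasSubst.of_constantCoeff_zero' hσ
  rw [← subst_comp_subst_apply hasSubst_vSeries hs, uSeries_subst_vSeries, subst_X hs]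

/-- w(s) = w(t) forces v(s) = ±v(t), and the plus sign gives s = t. Hence the deck transformation is
v ↦ -v. -/
theorem sInvSeries_eq : sInvSeries = (rescale (-1 : ℂ) uSeries).subst vSeries := by
  obtain ⟨h0, hX, hw⟩ := sInvSeries_spec
  have hs : HasSubst sInvSeries := HasSubst.of_constantCoeff_zero' h0
  have h1 : (vSeries.subst sInvSeries : PowerSeries ℂ) ^ 2 = vSeries ^ 2 := by
    rw [← subst_pow hs, vSeries_spec.2.2, two_mul, subst_add hs, hw]
  have h2 := uSeries_subst_vSeries_subst h0
  rcases sq_eq_sq_iff_eq_or_eq_neg.mp h1 with h | h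
  · rw [h, uSeries_subst_vSeries] at h2
    exact absurd h2.symm hX
  · rw [rescale_eq_subst, subst_comp_subst_apply (HasSubst.smul_X' _) hasSubst_vSeries,
      subst_smul hasSubst_vSeries, subst_X hasSubst_vSeries, neg_one_smul, ← h, h2]

theorem X_eq_subst_vSeries : (X : PowerSeries ℂ) = uSeries.subst vSeries :=
  uSeries_subst_vSeries.symm

theorem inv_tL : tL⁻¹ = ofPS X := by
  rw [tL, ofPS_X, HahnSeries.inv_single]; simp

theorem inv_sL : sL⁻¹ = ofPS sInvSeries := inv_inv _

theorem tL_ne_zero : tL ≠ 0 := HahnSeries.single_ne_zero one_ne_zero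

theorem coeff_one_sInvSeries : coeff 1 sInvSeries = -1 := by
  obtain ⟨y, hy, hy0⟩ := exists_vSeries_eq
  obtain ⟨q, hq⟩ := X_dvd_iff.mpr constantCoeff_uSeries
  have hv := hasSubst_vSeries
  have h1 : rescale (-1 : ℂ) uSeries = X * -rescale (-1 : ℂ) q := by
    ext k
    rcases k with _ | k
    · simp [constantCoeff_uSeries]
    · rw [coeff_succ_X_mul, coeff_rescale, hq, coeff_succ_X_mul, map_neg, coeff_rescale, pow_succ]
      ring
  have hq0 : constantCoeff q = 1 := by
    have := coeff_one_uSeries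
    rw [hq, show (1 : ℕ) = 0 + 1 from rfl, coeff_succ_X_mul] at this
    simpa using this
  have h2 : (-rescale (-1 : ℂ) q) = X * (PowerSeries.mk fun i => coeff (i + 1)
      (-rescale (-1 : ℂ) q)) + C (-1) := by
    have := eq_X_mul_shift_add_const (-rescale (-1 : ℂ) q)
    nth_rewrite 1 [this]
    congr 2
    rw [map_neg, ← coeff_zero_eq_constantCoeff_apply, coeff_rescale,
      coeff_zero_eq_constantCoeff_apply, hq0]
    simp
  rw [sInvSeries_eq, h1, h2, subst_mul hv, subst_add hv, subst_mul hv, subst_X hv,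
    show ((C (-1 : ℂ)).subst vSeries : PowerSeries ℂ) = C (-1) from subst_C _, hy, mul_assoc,
    show (1 : ℕ) = 0 + 1 from rfl, coeff_succ_X_mul]
  simp [hy0]

theorem sInvSeries_ne_zero : sInvSeries ≠ 0 := fun h => by
  have := coeff_one_sInvSeries
  rw [h] at this
  simp at this

theorem sL_ne_zero : sL ≠ 0 := inv_ne_zero (ofPS_ne_zero sInvSeries_ne_zero)

/-- η_{-1} is minus the odd part of u(v): this is where the Stirling evaluation enters. -/
theorem two_X_mul_etaSeries :
    2 * (X * etaSeries (-1)) = rescale (-1 : ℂ) uSeries - uSeries := by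
  ext j
  rw [← map_ofNat (C (R := ℂ)) 2, coeff_C_mul, map_sub, coeff_rescale]
  rcases j with _ | j
  · simp [constantCoeff_uSeries]
  · rw [coeff_succ_X_mul, etaSeries, coeff_mk]
    split_ifs with h
    · obtain ⟨k, rfl⟩ := h
      have h2 : (k + k) / 2 = k := by omega
      have h3 := coeff_uSeries_odd k
      have h4 := oddFactorial_ne_zero (k + 1)
      rw [h2, oddDoubleFactorial_neg, show k + k + 1 = 2 * k + 1 by ring, pow_succ _ (2 * k), pow_mul,
        neg_one_sq, one_pow, one_mul, pow_succ (-1 : ℂ) k]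
      field_simp
      norm_num
      linear_combination (-2) * h3
    · have h2 : Even (j + 1) := Nat.even_add_one.mpr h
      rw [h2.neg_one_pow]
      simp

theorem two_etaL_neg_one : 2 * etaL (-1) = sL⁻¹ - tL⁻¹ := by
  have hv := hasSubst_vSeries
  have h := congrArg (fun f : PowerSeries ℂ => ofPS (f.subst vSeries)) two_X_mul_etaSeries
  simp only [two_mul, subst_add hv, subst_sub hv, subst_mul hv, subst_X hv, ← sInvSeries_eq,
    uSeries_subst_vSeries, map_add, map_sub, map_mul, ← vL_eq] at h
  rw [inv_tL, inv_sL, ← h, etaL_eq, two_mul]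
  norm_num

/-! ### The odd and even parts of `ξ̂_n` -/

theorem ddt_tL : ddt tL = 1 := by
  ext n
  rw [coeff_ddt, tL, HahnSeries.coeff_single, HahnSeries.coeff_one]
  split_ifs with h1 h2 h2
  · subst h2; norm_num
  · omega
  · omega
  · simp

theorem two_mul_ofPS_wSeries : 2 * ofPS wSeries = vL ^ 2 := by
  rw [vL_eq, ← map_pow, vSeries_spec.2.2, map_mul, map_ofNat]

theorem wDeriv_eq : wDeriv = ddt (ofPS wSeries) := by
  have h := congrArg ddt two_mul_ofPS_wSeries
  rw [two_mul, sq, ddt_add, ddt_mul] at h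
  apply mul_left_cancel₀ two_ne_zero_laurentSeries
  rw [wDeriv]
  linear_combination -h

/-- Any solution `f` of `w(f) = w(t)` moves along the vector field dual to `dw`. -/
theorem ddt_eq_of_wSeries_subst {σ : PowerSeries ℂ} (hσ : constantCoeff σ = 0) (hσ0 : σ ≠ 0)
    (hw : wSeries.subst σ = wSeries) :
    ddt (ofPS σ)⁻¹ = -(wDeriv * ((ofPS σ)⁻¹ ^ 2 * ((ofPS σ)⁻¹ - 1))) := by
  have hs : HasSubst σ := HasSubst.of_constantCoeff_zero' hσ
  have h1 := ddt_ofPS_subst wSeries hs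
  rw [hw, ← wDeriv_eq] at h1
  have h2 := congrArg (fun f : PowerSeries ℂ => ofPS (f.subst σ)) derivative_wSeries_mul
  simp only [subst_mul hs, subst_sub hs, subst_X hs, one_subst hs, map_mul, map_sub,
    map_one] at h2
  have h3 := ofPS_ne_zero hσ0
  rw [ddt_inv, h1]
  field_simp
  linear_combination ddt (ofPS σ) * h2

theorem ddt_sL : ddt sL = -(wDeriv * (sL ^ 2 * (sL - 1))) :=
  ddt_eq_of_wSeries_subst sInvSeries_spec.1 sInvSeries_ne_zero sInvSeries_spec.2.2

theorem ddt_tL_eq : ddt tL = -(wDeriv * (tL ^ 2 * (tL - 1))) := by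
  have h := ddt_eq_of_wSeries_subst (σ := X) (by simp) X_ne_zero (X_subst _)
  rwa [← inv_tL, inv_inv] at h

theorem wDeriv_ne_zero : wDeriv ≠ 0 := fun h => by
  have := ddt_tL_eq
  rw [h, ddt_tL, zero_mul, neg_zero] at this
  exact one_ne_zero this

theorem xiHatAt_zero (f : LaurentSeries ℂ) : xiHatAt 0 f = f - 1 := by
  simp [xiHatAt, xiHat]

theorem ddt_xiHatAt {f : LaurentSeries ℂ} (hf : ddt f = -(wDeriv * (f ^ 2 * (f - 1)))) (n : ℕ) :
    ddt (xiHatAt n f) = -(wDeriv * xiHatAt (n + 1) f) := by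
  have h := ddtDerivation.map_aeval (xiHat n) f
  rw [ddtDerivation_apply, ddtDerivation_apply, hf, smul_eq_mul] at h
  rw [xiHatAt, h, xiHatAt, xiHat]
  simp only [map_mul, map_pow, map_sub, map_one, Polynomial.aeval_X]
  ring

/-- Thus -1/t plays the role of ξ̂_{-1}, which lets the ladder start at η_{-1}. -/
theorem ddt_neg_inv {f : LaurentSeries ℂ} (hf : ddt f = -(wDeriv * (f ^ 2 * (f - 1))))
    (hf0 : f ≠ 0) : ddt (-f⁻¹) = -(wDeriv * xiHatAt 0 f) := by
  rw [ddt_neg, ddt_inv, hf, xiHatAt_zero]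
  field_simp

/-- Both sides climb under -d/dw from their common value 1/s - 1/t at index -1, so no constants of
integration occur. -/
theorem two_etaL (n : ℕ) : 2 * etaL n = xiHatAt n tL - xiHatAt n sL := by
  have hd : ∀ m : ℤ, ddt (2 * etaL m) = -(wDeriv * (2 * etaL (m + 1))) := fun m => by
    rw [two_mul, ddt_add, ddt_etaL]; ring
  apply mul_left_cancel₀ (neg_ne_zero.mpr wDeriv_ne_zero)
  induction n with
  | zero =>
    have h1 := hd (-1)
    have h2 := ddt_neg_inv ddt_tL_eq tL_ne_zero
    have h3 := ddt_neg_inv ddt_sL sL_ne_zero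
    rw [two_etaL_neg_one, show sL⁻¹ - tL⁻¹ = -tL⁻¹ - -sL⁻¹ by ring, ddt_sub, h2, h3,
      show (-1 : ℤ) + 1 = ((0 : ℕ) : ℤ) by norm_num] at h1
    linear_combination -h1
  | succ n ih =>
    have ih' := mul_left_cancel₀ (neg_ne_zero.mpr wDeriv_ne_zero) ih
    have h1 := hd n
    rw [ih', ddt_sub, ddt_xiHatAt ddt_tL_eq, ddt_xiHatAt ddt_sL] at h1
    push_cast
    linear_combination -h1

theorem exists_even_eq_subst_sq {f : PowerSeries ℂ} (hf : ∀ j, ¬ Even j → coeff j f = 0) :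
    ∃ q : PowerSeries ℂ, f = q.subst (X ^ 2 : PowerSeries ℂ) := by
  refine ⟨PowerSeries.mk fun k => coeff (2 * k) f, ?_⟩
  ext j
  rw [coeff_subst_X_pow two_ne_zero]
  split_ifs with h
  · rw [coeff_mk, Nat.mul_div_cancel' h]; rfl
  · exact hf j fun h' => h h'.two_dvd

theorem hasSubst_vSeries_sq : HasSubst (vSeries ^ 2) :=
  HasSubst.of_constantCoeff_zero' (by rw [map_pow, vSeries_spec.1]; simp)

/-- Index -1 gives -(u(v) + u(-v)), a power series in v² = 2w. Applying -d/dw = -2 d/d(v²) keeps it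
one, so no pole ever appears. -/
theorem exists_xiHatAt_add (n : ℕ) :
    ∃ q : PowerSeries ℂ, xiHatAt n tL + xiHatAt n sL = ofPS (q.subst (vSeries ^ 2)) := by
  have hd : ∀ q : PowerSeries ℂ, ddt (ofPS (q.subst (vSeries ^ 2))) =
      -(wDeriv * ofPS ((-(2 * derivative ℂ q)).subst (vSeries ^ 2))) := fun q => by
    have h1 : ddt (ofPS (vSeries ^ 2)) = 2 * wDeriv := by
      rw [vSeries_spec.2.2, two_mul, map_add, ddt_add, ← wDeriv_eq, two_mul]
    rw [ddt_ofPS_subst _ hasSubst_vSeries_sq, h1, ← coe_substAlgHom hasSubst_vSeries_sq, map_neg,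
      two_mul (derivative ℂ q), map_add, map_neg, map_add]
    ring
  induction n with
  | zero =>
    obtain ⟨q, hq⟩ := exists_even_eq_subst_sq (f := -(uSeries + rescale (-1 : ℂ) uSeries))
      fun j hj => by
        rw [map_neg, map_add, coeff_rescale, (Nat.not_even_iff_odd.mp hj).neg_one_pow]; ring
    have h1 : ofPS (q.subst (vSeries ^ 2)) = -tL⁻¹ + -sL⁻¹ := by
      rw [inv_tL, inv_sL, sInvSeries_eq, X_eq_subst_vSeries]
      have h2 := congrArg (fun f : PowerSeries ℂ => ofPS (f.subst vSeries)) hq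
      simp only [subst_comp_subst_apply (HasSubst.X_pow two_ne_zero) hasSubst_vSeries,
        subst_pow hasSubst_vSeries, subst_X hasSubst_vSeries] at h2
      rw [← h2, ← coe_substAlgHom hasSubst_vSeries, map_neg, map_add, map_neg, map_add]
      ring
    refine ⟨-(2 * derivative ℂ q), ?_⟩
    apply mul_left_cancel₀ (neg_ne_zero.mpr wDeriv_ne_zero)
    have h3 := hd q
    rw [h1, ddt_add, ddt_neg_inv ddt_tL_eq tL_ne_zero, ddt_neg_inv ddt_sL sL_ne_zero] at h3
    linear_combination h3
  | succ n ih =>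
    obtain ⟨q, hq⟩ := ih
    refine ⟨-(2 * derivative ℂ q), ?_⟩
    apply mul_left_cancel₀ (neg_ne_zero.mpr wDeriv_ne_zero)
    have h3 := hd q
    rw [← hq, ddt_add, ddt_xiHatAt ddt_tL_eq, ddt_xiHatAt ddt_sL] at h3
    linear_combination h3

/-! ### Expansions in two variables -/

/-- The coefficient of `t_j ^ (-k)`, a Laurent series in `1/t`. -/
def tjCoeff (k : ℤ) (A : LaurentSeries (LaurentSeries ℂ)) : LaurentSeries ℂ :=
  ⟨fun n => (A.coeff n).coeff k, A.isPWO_support.mono fun n hn h0 => hn (by simp [h0])⟩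

theorem coeff_tjCoeff (k n : ℤ) (A : LaurentSeries (LaurentSeries ℂ)) :
    (tjCoeff k A).coeff n = (A.coeff n).coeff k := rfl

theorem support_tjCoeff (k : ℤ) (A : LaurentSeries (LaurentSeries ℂ)) :
    (tjCoeff k A).support ⊆ A.support := fun n hn h0 => hn (by rw [coeff_tjCoeff, h0]; rfl)

theorem tjCoeff_add (k : ℤ) (A B : LaurentSeries (LaurentSeries ℂ)) :
    tjCoeff k (A + B) = tjCoeff k A + tjCoeff k B := by
  ext n
  rfl

theorem tjCoeff_sum {ι : Type*} (k : ℤ) (s : Finset ι) (A : ι → LaurentSeries (LaurentSeries ℂ)) :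
    tjCoeff k (∑ i ∈ s, A i) = ∑ i ∈ s, tjCoeff k (A i) := by
  classical
  induction s using Finset.induction_on with
  | empty => ext n; simp [coeff_tjCoeff]
  | insert a s ha ih => rw [Finset.sum_insert ha, Finset.sum_insert ha, tjCoeff_add, ih]

theorem coeff_inT (f : LaurentSeries ℂ) (n : ℤ) :
    (inT f).coeff n = HahnSeries.C (f.coeff n) := rfl

theorem support_inT (f : LaurentSeries ℂ) : (inT f).support ⊆ f.support := fun n hn h0 =>
  hn (by rw [coeff_inT, h0, map_zero])

/-- Linearity over series in 1/t reduces the comparison of two-variable forms to one-variable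
identities, one power of t_j at a time. -/
theorem tjCoeff_inT_mul (k : ℤ) (f : LaurentSeries ℂ) (A : LaurentSeries (LaurentSeries ℂ)) :
    tjCoeff k (inT f * A) = f * tjCoeff k A := by
  ext n
  rw [coeff_tjCoeff, HahnSeries.coeff_mul_left' f.isPWO_support (support_inT f),
    HahnSeries.coeff_mul_right' A.isPWO_support (support_tjCoeff k A), HahnSeries.coeff_sum]
  refine Finset.sum_congr rfl fun p _ => ?_
  rw [coeff_inT, HahnSeries.C_mul_eq_smul, HahnSeries.coeff_smul, coeff_tjCoeff, smul_eq_mul]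

theorem inT_mul (f g : LaurentSeries ℂ) : inT (f * g) = inT f * inT g := by
  ext1
  funext n
  have h : (inT f * inT g).coeff n = ∑ p ∈ Finset.antidiagonal f.isPWO_support
      g.isPWO_support n, (inT f).coeff p.1 * (inT g).coeff p.2 := by
    rw [HahnSeries.coeff_mul]
    refine Finset.sum_subset (fun p hp => ?_) fun p _ hp => ?_
    · have := Finset.mem_antidiagonal.mp hp
      exact Finset.mem_antidiagonal.mpr ⟨support_inT f this.1, support_inT g this.2.1, this.2.2⟩
    · by_contra h0
      refine hp (Finset.mem_antidiagonal.mpr ⟨left_ne_zero_of_mul h0, right_ne_zero_of_mul h0, ?_⟩)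
      exact (Finset.mem_antidiagonal.mp ‹_›).2.2
  rw [h, coeff_inT, HahnSeries.coeff_mul, map_sum]
  exact Finset.sum_congr rfl fun p _ => map_mul HahnSeries.C _ _

theorem inT_one : inT 1 = 1 := by
  ext1
  funext n
  rw [coeff_inT, HahnSeries.coeff_one, HahnSeries.coeff_one]
  split_ifs
  · exact map_one _
  · exact map_zero _

/-- `inT` as a ring homomorphism. -/
def inTHom : LaurentSeries ℂ →+* LaurentSeries (LaurentSeries ℂ) where
  toFun := inT
  map_one' := inT_one
  map_mul' := inT_mul
  map_zero' := by ext1; funext n; rw [coeff_inT]; simp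
  map_add' f g := by ext1; funext n; rw [coeff_inT]; simp [coeff_inT]

theorem inT_sub (f g : LaurentSeries ℂ) : inT (f - g) = inT f - inT g := by
  ext1
  funext n
  rw [coeff_inT, HahnSeries.coeff_sub, HahnSeries.coeff_sub, coeff_inT, coeff_inT, map_sub]

theorem inTHom_apply (f : LaurentSeries ℂ) : inTHom f = inT f := rfl

theorem tjCoeff_inTj (k : ℤ) (g : LaurentSeries ℂ) :
    tjCoeff k (inTj g) = HahnSeries.C (g.coeff k) := by
  ext n
  rw [coeff_tjCoeff, inTj, HahnSeries.C_apply, HahnSeries.C_apply, HahnSeries.coeff_single,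
    HahnSeries.coeff_single]
  split_ifs <;> simp

theorem tjCoeff_inTj_tL_mul (k : ℤ) (A : LaurentSeries (LaurentSeries ℂ)) :
    tjCoeff k (inTj tL * A) = tjCoeff (k + 1) A := by
  ext n
  rw [coeff_tjCoeff, coeff_tjCoeff, inTj, HahnSeries.C_mul_eq_smul, HahnSeries.coeff_smul,
    smul_eq_mul, tL, HahnSeries.coeff_single_mul, one_mul, sub_neg_eq_add]

theorem tjCoeff_one (k : ℤ) : tjCoeff k 1 = if k = 0 then 1 else 0 := by
  have : (1 : LaurentSeries (LaurentSeries ℂ)) = inTj 1 := (map_one HahnSeries.C).symm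
  rw [this, tjCoeff_inTj, HahnSeries.coeff_one]
  split_ifs
  · exact map_one _
  · exact map_zero _

theorem inT_sub_inTj_ne_zero (f : LaurentSeries ℂ) : inT f - inTj tL ≠ 0 := by
  intro h
  have h1 := congrArg (fun A => (HahnSeries.coeff (HahnSeries.coeff A 0) (-1)))
    (sub_eq_zero (a := inT f) (b := inTj tL) |>.mp h)
  simp only [coeff_inT] at h1
  have h2 : (inTj tL).coeff 0 = tL := by
    rw [inTj, HahnSeries.C_apply, HahnSeries.coeff_single_same]
  rw [h2, tL, HahnSeries.coeff_single_same, HahnSeries.C_apply,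
    HahnSeries.coeff_single_of_ne (by norm_num)] at h1
  exact zero_ne_one h1

/-! ### Geometric expansion of 1/(f - t_j) -/

theorem mul_inv_sub_eq {F : Type*} [Field F] {x y : F} (h : x - y ≠ 0) :
    x * (x - y)⁻¹ = 1 + y * (x - y)⁻¹ := by
  linear_combination mul_inv_cancel₀ h

theorem tjCoeff_geometric_rec {f : LaurentSeries ℂ} (hf : f ≠ 0) (k : ℤ) :
    tjCoeff k (inT f - inTj tL)⁻¹ =
      f⁻¹ * ((if k = 0 then 1 else 0) + tjCoeff (k + 1) (inT f - inTj tL)⁻¹) := by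
  have h : inT f * (inT f - inTj tL)⁻¹ = 1 + inTj tL * (inT f - inTj tL)⁻¹ := by
    exact mul_inv_sub_eq (F := LaurentSeries (LaurentSeries ℂ)) (inT_sub_inTj_ne_zero f)
  have h1 := congrArg (tjCoeff k) h
  rw [tjCoeff_inT_mul, tjCoeff_add, tjCoeff_inTj_tL_mul, tjCoeff_one] at h1
  rw [← h1, inv_mul_cancel_left₀ hf]

/-- For negative powers of t_j the recursion has no source term. Iterating it extracts arbitrarily
high powers of 1/f, while the order in 1/t stays bounded below by that of the whole series. -/
theorem tjCoeff_geometric_pos {f : LaurentSeries ℂ} (hf : f ≠ 0) {p : PowerSeries ℂ}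
    (hp : f⁻¹ = ofPS (X * p)) {k : ℤ} (hk : 0 < k) : tjCoeff k (inT f - inTj tL)⁻¹ = 0 := by
  set A := (inT f - inTj tL)⁻¹ with hA
  have h : ∀ r : ℕ, tjCoeff k A = f⁻¹ ^ r * tjCoeff (k + r) A := by
    intro r
    induction r with
    | zero => simp
    | succ r ih =>
      rw [ih, tjCoeff_geometric_rec hf (k + r), if_neg (by omega), zero_add, pow_succ, mul_assoc]
      push_cast
      rw [add_assoc]
  ext n
  have h1 : ((A.order : ℤ) : WithTop ℤ) ≤ (tjCoeff (k + ((n - A.order).toNat + 1 : ℕ)) A).orderTop :=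
    le_orderTop_iff.mpr fun i hi => by
      rw [coeff_tjCoeff, HahnSeries.coeff_eq_zero_of_lt_order hi, HahnSeries.coeff_zero]
  rw [h ((n - A.order).toNat + 1), hp, ← map_pow, mul_pow]
  rw [le_orderTop_iff.mp (le_orderTop_mul (le_orderTop_ofPS_X_pow_mul _ _) h1) n
    (by push_cast; omega), HahnSeries.coeff_zero]

theorem tjCoeff_geometric_neg {f : LaurentSeries ℂ} (hf : f ≠ 0) {p : PowerSeries ℂ}
    (hp : f⁻¹ = ofPS (X * p)) (k : ℕ) :
    tjCoeff (-(k : ℤ)) (inT f - inTj tL)⁻¹ = f⁻¹ ^ (k + 1) := by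
  induction k with
  | zero =>
    rw [tjCoeff_geometric_rec hf, if_pos (by simp), tjCoeff_geometric_pos hf hp (by simp)]
    simp
  | succ k ih =>
    rw [tjCoeff_geometric_rec hf, if_neg (by push_cast; omega), zero_add,
      show -((k + 1 : ℕ) : ℤ) + 1 = -(k : ℤ) by push_cast; ring, ih, pow_succ' _ (k + 1)]

theorem exists_inv_sL : ∃ p : PowerSeries ℂ, sL⁻¹ = ofPS (X * p) := by
  obtain ⟨p, hp⟩ := X_dvd_iff.mpr sInvSeries_spec.1
  exact ⟨p, by rw [inv_sL, ← hp]⟩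

theorem exists_inv_tL : ∃ p : PowerSeries ℂ, tL⁻¹ = ofPS (X * p) :=
  ⟨1, by rw [inv_tL, mul_one]⟩

/-! ### The two forms, coefficient by coefficient -/

theorem inv_etaL_neg_one : tL * sL / (tL - sL) = (2 * etaL (-1))⁻¹ := by
  rw [two_etaL_neg_one, inv_sub_inv sL_ne_zero tL_ne_zero, inv_div, mul_comm sL]

theorem kernelForm_eq (n : ℕ) : kernelForm n =
    inT ((2 * etaL (-1))⁻¹) * (inT (xiHatAt (n + 1) tL * ddt sL) * (inT sL - inTj tL)⁻¹ +
      inT (xiHatAt (n + 1) sL) * (inT tL - inTj tL)⁻¹) := by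
  rw [← inv_etaL_neg_one, kernelForm, ← inT_sub]
  simp only [← inTHom_apply, map_mul, div_eq_mul_inv, map_inv₀]

theorem tjCoeff_kernelForm_pos (n : ℕ) {k : ℤ} (hk : 0 < k) : tjCoeff k (kernelForm n) = 0 := by
  obtain ⟨p, hp⟩ := exists_inv_sL
  obtain ⟨q, hq⟩ := exists_inv_tL
  rw [kernelForm_eq, tjCoeff_inT_mul, tjCoeff_add, tjCoeff_inT_mul, tjCoeff_inT_mul,
    tjCoeff_geometric_pos sL_ne_zero hp hk, tjCoeff_geometric_pos tL_ne_zero hq hk]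
  ring

theorem tjCoeff_kernelForm (n k : ℕ) : tjCoeff (-(k : ℤ)) (kernelForm n) =
    (2 * etaL (-1))⁻¹ * (xiHatAt (n + 1) tL * (ddt sL * sL⁻¹ ^ (k + 1)) +
      xiHatAt (n + 1) sL * tL⁻¹ ^ (k + 1)) := by
  obtain ⟨p, hp⟩ := exists_inv_sL
  obtain ⟨q, hq⟩ := exists_inv_tL
  rw [kernelForm_eq, tjCoeff_inT_mul, tjCoeff_add, tjCoeff_inT_mul, tjCoeff_inT_mul,
    tjCoeff_geometric_neg sL_ne_zero hp, tjCoeff_geometric_neg tL_ne_zero hq, mul_assoc]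

theorem sum_geometric_form {F : Type*} [Field F] (a e w d : F) {v : F} (hv : v ≠ 0) (M : ℕ) :
    a / e * (1 / v ^ 2 * ∑ m ∈ Finset.range (M + 1), (w / v) ^ (2 * m)) * (v * d) =
      ∑ m ∈ Finset.range (M + 1), e⁻¹ * ((v ^ (2 * m + 1))⁻¹ * d) * (a * w ^ (2 * m)) := by
  rw [Finset.mul_sum, Finset.mul_sum, Finset.sum_mul]
  refine Finset.sum_congr rfl fun m _ => ?_
  rw [div_pow, pow_succ v (2 * m)]
  field_simp

theorem etaForm_eq (n M : ℕ) : etaForm n M = ∑ m ∈ Finset.range (M + 1),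
    inT ((etaL (-1))⁻¹ * (vL ^ (-((2 * m + 1 : ℕ) : ℤ)) * ddt vL)) *
      inTj (etaL (n + 1) * vL ^ (2 * m)) := by
  have hv : inTHom vL ≠ 0 := (map_ne_zero inTHom).mpr vL_ne_zero
  have hj : ∀ f g, inTj (f * g) = inTj f * inTj g := fun f g => map_mul HahnSeries.C f g
  have hjp : ∀ f (r : ℕ), inTj (f ^ r) = inTj f ^ r := fun f r => map_pow HahnSeries.C f r
  simp only [← inTHom_apply, map_mul, map_inv₀, zpow_neg, zpow_natCast, map_pow, hj, hjp]
  exact sum_geometric_form (F := LaurentSeries (LaurentSeries ℂ)) _ _ _ _ hv M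

theorem tjCoeff_etaForm (n M : ℕ) (k : ℤ) : tjCoeff k (etaForm n M) =
    (etaL (-1))⁻¹ * ((∑ m ∈ Finset.range (M + 1),
      HahnSeries.C ((etaL (n + 1) * vL ^ (2 * m)).coeff k) * vL ^ (-((2 * m + 1 : ℕ) : ℤ))) *
        ddt vL) := by
  rw [etaForm_eq, tjCoeff_sum, Finset.sum_mul, Finset.mul_sum]
  refine Finset.sum_congr rfl fun m _ => ?_
  rw [tjCoeff_inT_mul, tjCoeff_inTj]
  ring

/-! ### Comparison of the two forms -/

theorem coeff_neg_eq_coeff_one_mul (H : LaurentSeries ℂ) (k : ℕ) :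
    H.coeff (-(k : ℤ)) = (H * ofPS (X ^ (k + 1))).coeff 1 := by
  rw [map_pow, ofPS_X, HahnSeries.single_pow, HahnSeries.coeff_mul_single, one_pow, mul_one]
  congr 1
  simp

theorem ddt_ofPS_X_pow (k : ℕ) :
    ddt (ofPS (X ^ k)) = -(HahnSeries.C (k : ℂ) * ofPS (X ^ (k + 1))) := by
  rw [ddt_ofPS, derivative_pow, derivative_X, mul_one, ← HahnSeries.ofPowerSeries_C, ← map_mul]
  congr 2
  rcases k with _ | k
  · simp
  · rw [Nat.add_sub_cancel]
    push_cast
    simp only [map_add, map_natCast, map_one]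
    ring

theorem X_pow_eq_subst_vSeries (k : ℕ) :
    (X : PowerSeries ℂ) ^ k = (uSeries ^ k).subst vSeries := by
  rw [subst_pow hasSubst_vSeries, uSeries_subst_vSeries]

/-- Lagrange inversion for the coefficients of `η_n(v) v ^ (2m)` at powers of `t`. -/
theorem coeff_etaL_mul {n : ℤ} {k m r : ℕ} (hr : (r : ℤ) + 2 * m = 2 * n) :
    (k : ℂ) * (etaL n * vL ^ (2 * m)).coeff (-(k : ℤ)) =
      coeff r (etaSeries n * derivative ℂ (uSeries ^ k)) := by
  have h1 : etaL n * vL ^ (2 * m) =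
      vL ^ (-((r + 1 : ℕ) : ℤ)) * ofPS ((etaSeries n).subst vSeries) := by
    rw [etaL_eq, mul_right_comm, ← zpow_natCast, ← zpow_add₀ vL_ne_zero]
    congr 2
    push_cast
    omega
  have h2 := residue_vL (etaSeries n * derivative ℂ (uSeries ^ k)) r
  have h3 := ddt_ofPS_subst (uSeries ^ k) hasSubst_vSeries
  rw [← X_pow_eq_subst_vSeries, ddt_ofPS_X_pow] at h3
  have h4 : vL ^ (-((r + 1 : ℕ) : ℤ)) *
      ofPS ((etaSeries n * derivative ℂ (uSeries ^ k)).subst vSeries) * ddt vL =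
      -(HahnSeries.C (k : ℂ) * (etaL n * vL ^ (2 * m) * ofPS (X ^ (k + 1)))) := by
    rw [h1, subst_mul hasSubst_vSeries, map_mul, vL_eq]
    rw [vL_eq.symm] at h3 ⊢
    linear_combination -(vL ^ (-((r + 1 : ℕ) : ℤ)) * ofPS ((etaSeries n).subst vSeries)) * h3
  rw [h4, HahnSeries.coeff_neg, HahnSeries.C_mul_eq_smul, HahnSeries.coeff_smul, smul_eq_mul,
    ← coeff_neg_eq_coeff_one_mul] at h2
  exact neg_injective h2

theorem le_orderTop_vL_pow_mul (a : ℕ) (p : PowerSeries ℂ) :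
    ((a : ℤ) : WithTop ℤ) ≤ (vL ^ a * ofPS p).orderTop := by
  obtain ⟨y, hy, -⟩ := exists_vSeries_eq
  rw [vL_eq, ← map_pow, ← map_mul, hy, mul_pow, mul_assoc]
  exact le_orderTop_ofPS_X_pow_mul _ _

/-- For m > n the product has no pole in v, so raising the upper limit M beyond n + 1 changes
nothing at positive powers of t_j. -/
theorem coeff_etaL_mul_eq_zero {n : ℤ} {k m : ℕ} (hk : 0 < k) (hm : n < m) :
    (etaL n * vL ^ (2 * m)).coeff (-(k : ℤ)) = 0 := by
  obtain ⟨a, ha⟩ : ∃ a : ℕ, (a : ℤ) = 2 * m - (2 * n + 1) :=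
    ⟨(2 * m - (2 * n + 1)).toNat, by omega⟩
  have h1 : etaL n * vL ^ (2 * m) = vL ^ a * ofPS ((etaSeries n).subst vSeries) := by
    rw [etaL_eq, mul_right_comm, ← zpow_natCast, ← zpow_add₀ vL_ne_zero, ← zpow_natCast vL a]
    congr 2
    push_cast
    omega
  rw [h1]
  exact le_orderTop_iff.mp (le_orderTop_vL_pow_mul _ _) _ (by omega)

theorem sum_even_range {R : Type*} [CommRing R] (g : ℕ → R) (J : ℕ) :
    ∑ i ∈ Finset.range (2 * J + 1), (1 + (-1) ^ i) * g i =
      2 * ∑ j ∈ Finset.range (J + 1), g (2 * j) := by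
  induction J with
  | zero =>
    rw [mul_zero, zero_add, Finset.sum_range_one, Finset.sum_range_one]
    ring
  | succ J ih =>
    have e1 : (-1 : R) ^ (2 * J + 1) = -1 := (odd_two_mul_add_one J).neg_one_pow
    have e2 : (-1 : R) ^ (2 * J + 1 + 1) = 1 :=
      (odd_two_mul_add_one J).add_one.neg_one_pow
    rw [show 2 * (J + 1) + 1 = 2 * J + 1 + 1 + 1 by ring, Finset.sum_range_succ,
      Finset.sum_range_succ, ih, Finset.sum_range_succ _ (J + 1),
      show 2 * (J + 1) = 2 * J + 1 + 1 by ring, e1, e2]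
    ring

theorem rescale_etaSeries (n : ℤ) : rescale (-1 : ℂ) (etaSeries n) = etaSeries n := by
  ext j
  rw [coeff_rescale]
  by_cases hj : Even j
  · rw [hj.neg_one_pow, one_mul]
  · rw [coeff_etaSeries_odd n hj, mul_zero]

/-- The principal part of `η_{n+1}(v) d(t^{-k} - s^{-k})/dv` in powers of `v`. -/
theorem exists_etaL_mul_ddt {n k M : ℕ} (hk : 0 < k) (hM : n + 1 ≤ M) : ∃ R : PowerSeries ℂ,
    etaL (n + 1) * ddt (tL⁻¹ ^ k - sL⁻¹ ^ k) =
      (2 * (HahnSeries.C (k : ℂ) * ∑ m ∈ Finset.range (M + 1),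
        HahnSeries.C ((etaL (n + 1) * vL ^ (2 * m)).coeff (-(k : ℤ))) *
          vL ^ (-((2 * m + 1 : ℕ) : ℤ))) + ofPS R) * ddt vL := by
  have hv := hasSubst_vSeries
  set W := derivative ℂ (uSeries ^ k) with hW
  set B := etaSeries (n + 1) * W with hB
  obtain ⟨R, hR⟩ := exists_principal_part (B + rescale (-1 : ℂ) B) (2 * n + 3)
  refine ⟨R.subst vSeries, ?_⟩
  have h1 : tL⁻¹ ^ k - sL⁻¹ ^ k =
      ofPS ((uSeries ^ k - rescale (-1 : ℂ) (uSeries ^ k)).subst vSeries) := by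
    rw [inv_tL, inv_sL, sInvSeries_eq, ← map_pow, ← map_pow, ← map_sub, subst_sub hv,
      ← X_pow_eq_subst_vSeries, map_pow (rescale (-1 : ℂ)), subst_pow hv]
  -- Subtracting s^{-k} symmetrizes: u^k(v) - u^k(-v) is odd, its derivative is even, and
  -- `etaSeries` is even.
  have h2 : etaSeries (n + 1) *
      derivative ℂ (uSeries ^ k - rescale (-1 : ℂ) (uSeries ^ k)) = B + rescale (-1 : ℂ) B := by
    rw [map_sub, derivative_rescale_neg_one, hB, map_mul (rescale (-1 : ℂ)), rescale_etaSeries]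
    ring
  have h3 : ∀ i, HahnSeries.C (coeff i (B + rescale (-1 : ℂ) B)) =
      (1 + (-1) ^ i) * (HahnSeries.C (coeff i B) : LaurentSeries ℂ) := fun i => by
    rw [map_add, coeff_rescale, map_add, map_mul HahnSeries.C, map_pow HahnSeries.C,
      map_neg HahnSeries.C, map_one HahnSeries.C]
    ring
  obtain ⟨c, hc⟩ : ∃ c : ℕ → ℂ, ∀ m, c m = (etaL (n + 1) * vL ^ (2 * m)).coeff (-(k : ℤ)) :=
    ⟨_, fun _ => rfl⟩
  simp only [← hc]
  rw [h1, ddt_ofPS_subst _ hv, ← vL_eq, etaL_eq, ← mul_assoc]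
  congr 1
  rw [mul_assoc, ← map_mul, ← subst_mul hv, h2,
    show -(2 * ((n : ℤ) + 1) + 1) = -((2 * n + 3 : ℕ) : ℤ) by push_cast; ring, hR]
  congr 1
  simp only [h3, mul_assoc]
  -- Only even i = 2j survive; reflecting j = n + 1 - m turns v^{i - (2n+3)} into v^{-(2m+1)}.
  rw [show 2 * n + 3 = 2 * (n + 1) + 1 by ring,
    sum_even_range (fun i => HahnSeries.C (coeff i B) * vL ^ ((i : ℤ) - (2 * (n + 1) + 1 : ℕ))),
    ← Finset.sum_range_reflect, Finset.mul_sum (Finset.range (M + 1))]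
  congr 1
  rw [← Finset.sum_subset (Finset.range_subset_range.mpr (show n + 1 + 1 ≤ M + 1 by omega))]
  · refine Finset.sum_congr rfl fun m hm => ?_
    have hm' := Finset.mem_range.mp hm
    have h4 := coeff_etaL_mul (n := n + 1) (k := k) (m := m) (r := 2 * (n + 1 + 1 - 1 - m))
      (by push_cast; omega)
    rw [← mul_assoc, ← map_mul, hc, h4]
    congr 2
    omega
  · intro m _ hm
    have hm' : n + 1 + 1 ≤ m := by simpa using hm
    rw [hc, coeff_etaL_mul_eq_zero hk (by omega), map_zero]
    ring

/-- η_{-1} is v times a unit, so its inverse grows at most like t. -/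
theorem le_orderTop_inv_etaL : ((-1 : ℤ) : WithTop ℤ) ≤ (etaL (-1))⁻¹.orderTop := by
  obtain ⟨y, hy, hy0⟩ := exists_vSeries_eq
  have h0 : constantCoeff (y * (etaSeries (-1)).subst vSeries) ≠ 0 := by
    have h1 := PowerSeries.sub_const_eq_X_mul_shift (etaSeries (-1))
    have h2 := congrArg (fun f : PowerSeries ℂ => constantCoeff (f.subst vSeries : PowerSeries ℂ)) h1
    simp only [subst_sub hasSubst_vSeries, subst_mul hasSubst_vSeries, subst_X hasSubst_vSeries,
      map_sub, map_mul, vSeries_spec.1, zero_mul] at h2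
    rw [show ((C (constantCoeff (etaSeries (-1)))).subst vSeries : PowerSeries ℂ) =
      C (constantCoeff (etaSeries (-1))) from subst_C _, constantCoeff_C,
      constantCoeff_etaSeries, sub_eq_zero] at h2
    rw [map_mul, hy0, one_mul, h2]
    exact oddDoubleFactorial_ne_zero _
  have h1 : (etaL (-1))⁻¹ = HahnSeries.single (-1) 1 *
      ofPS (y * (etaSeries (-1)).subst vSeries)⁻¹ := by
    apply inv_eq_of_mul_eq_one_right
    have h2 : HahnSeries.single 1 1 * HahnSeries.single (-1) 1 = (1 : LaurentSeries ℂ) := by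
      rw [HahnSeries.single_mul_single]; simp
    have h3 := congrArg ofPS (PowerSeries.mul_inv_cancel _ h0)
    rw [map_mul, map_one] at h3
    have h4 : etaL (-1) = HahnSeries.single 1 1 * ofPS (y * (etaSeries (-1)).subst vSeries) := by
      rw [etaL_eq, ← ofPS_X, ← map_mul, ← mul_assoc, ← hy, map_mul, vL_eq]
      norm_num
    rw [h4]
    linear_combination (HahnSeries.single 1 1 * HahnSeries.single (-1) 1) * h3 + h2
  have h2 : ((-1 : ℤ) : WithTop ℤ) ≤
      (HahnSeries.single (-1) 1 : LaurentSeries ℂ).orderTop := HahnSeries.orderTop_single_le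
  rw [h1]
  exact le_orderTop_mul h2 (le_orderTop_ofPS _)

theorem le_orderTop_ddt_inv_pow {k : ℕ} {f : LaurentSeries ℂ} {p : PowerSeries ℂ}
    (hp : f⁻¹ = ofPS (X * p)) : ((k + 1 : ℤ) : WithTop ℤ) ≤ (ddt (f⁻¹ ^ k)).orderTop := by
  rw [hp, ← map_pow, mul_pow]
  exact le_orderTop_ddt (le_orderTop_ofPS_X_pow_mul _ _)

theorem ddt_inv_pow (f : LaurentSeries ℂ) (k : ℕ) :
    ddt (f⁻¹ ^ k) = -((k : LaurentSeries ℂ) * (ddt f * f⁻¹ ^ (k + 1))) := by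
  rw [← zpow_natCast, ddt_zpow, ddt_inv]
  rcases k with _ | k
  · simp
  · rw [show (((k + 1 : ℕ) : ℤ) - 1) = (k : ℤ) by push_cast; ring, zpow_natCast]
    push_cast
    ring

/-- At `t_j ^ k` with `k ≥ 1` the two forms have the same polynomial part in `t`. -/
theorem coeff_tjCoeff_kernelForm_eq {n k M : ℕ} (hk : 0 < k) (hM : n + 1 ≤ M) {i : ℤ}
    (hi : i ≤ 0) :
    (tjCoeff (-(k : ℤ)) (kernelForm n)).coeff i =
      (tjCoeff (-(k : ℤ)) (etaForm n M)).coeff i := by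
  obtain ⟨q, hq⟩ := exists_xiHatAt_add (n + 1)
  obtain ⟨R, hR⟩ := exists_etaL_mul_ddt hk hM
  obtain ⟨p₁, hp₁⟩ := exists_inv_sL
  obtain ⟨p₂, hp₂⟩ := exists_inv_tL
  have hη := two_etaL (n + 1)
  push_cast at hη
  set S := ∑ m ∈ Finset.range (M + 1),
    HahnSeries.C ((etaL (n + 1) * vL ^ (2 * m)).coeff (-(k : ℤ))) *
      vL ^ (-((2 * m + 1 : ℕ) : ℤ)) with hS
  have ha := ddt_inv_pow sL k
  have hb := ddt_inv_pow tL k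
  rw [ddt_tL, one_mul] at hb
  have hck : HahnSeries.C (k : ℂ) = (k : LaurentSeries ℂ) := map_natCast _ k
  rw [hck, ddt_sub] at hR
  -- The 4 clears the halves in 1/(2η_{-1}) and in the half sum and half difference of ξ̂; the k
  -- comes from d(s^{-k}) = -k s^{-k-1} ds.
  have hdiff : HahnSeries.C (4 * (k : ℂ)) * tjCoeff (-(k : ℤ)) (kernelForm n) =
      HahnSeries.C (4 * (k : ℂ)) * tjCoeff (-(k : ℤ)) (etaForm n M) +
        (etaL (-1))⁻¹ * (2 * (ofPS R * ddt vL) -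
          ofPS (q.subst (vSeries ^ 2)) * (ddt (sL⁻¹ ^ k) + ddt (tL⁻¹ ^ k))) := by
    have h4 : (HahnSeries.C (4 * (k : ℂ)) : LaurentSeries ℂ) = 4 * (k : LaurentSeries ℂ) := by
      rw [map_mul, hck, map_ofNat]
    have h2 : (2 : LaurentSeries ℂ) * 2⁻¹ = 1 := mul_inv_cancel₀ two_ne_zero_laurentSeries
    rw [tjCoeff_kernelForm, tjCoeff_etaForm, ← hS, h4, ← hq, mul_inv]
    rw [ha, hb] at hR ⊢
    set a := ddt sL * sL⁻¹ ^ (k + 1)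
    set b := tL⁻¹ ^ (k + 1)
    linear_combination 2 * (k : LaurentSeries ℂ) * (etaL (-1))⁻¹ *
      (xiHatAt (n + 1) tL * a + xiHatAt (n + 1) sL * b) * h2 + 2 * (etaL (-1))⁻¹ * hR -
      (k : LaurentSeries ℂ) * (etaL (-1))⁻¹ * (a - b) * hη
  -- The remainder has order at least -1 + 2 = 1: dv/dt vanishes to order two, and so do the
  -- derivatives of t^{-k} and s^{-k} because k ≥ 1.
  have hord : ((1 : ℤ) : WithTop ℤ) ≤ ((etaL (-1))⁻¹ * (2 * (ofPS R * ddt vL) -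
      ofPS (q.subst (vSeries ^ 2)) * (ddt (sL⁻¹ ^ k) + ddt (tL⁻¹ ^ k)))).orderTop := by
    have hv : ((1 : ℤ) : WithTop ℤ) ≤ vL.orderTop := by
      simpa using le_orderTop_vL_pow_mul 1 1
    have h2 : ∀ f : LaurentSeries ℂ, ((k + 1 : ℤ) : WithTop ℤ) ≤ f.orderTop →
        ((2 : ℤ) : WithTop ℤ) ≤ f.orderTop := fun f hf =>
      le_trans (WithTop.coe_le_coe.mpr (by omega)) hf
    have h3 := le_orderTop_mul (le_orderTop_ofPS (2 * R)) (le_orderTop_ddt hv)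
    have h4 := le_orderTop_mul (le_orderTop_ofPS (-(q.subst (vSeries ^ 2))))
      (le_orderTop_add (h2 _ (le_orderTop_ddt_inv_pow hp₁)) (h2 _ (le_orderTop_ddt_inv_pow hp₂)))
    have h5 := le_orderTop_mul le_orderTop_inv_etaL (le_orderTop_add h3 h4)
    have h6 : ofPS (2 * R) * ddt vL + ofPS (-(q.subst (vSeries ^ 2))) *
        (ddt (sL⁻¹ ^ k) + ddt (tL⁻¹ ^ k)) = 2 * (ofPS R * ddt vL) -
      ofPS (q.subst (vSeries ^ 2)) * (ddt (sL⁻¹ ^ k) + ddt (tL⁻¹ ^ k)) := by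
      rw [map_mul, map_neg, map_ofNat]; ring
    rwa [h6] at h5
  have h := congrArg (fun f : LaurentSeries ℂ => f.coeff i) hdiff
  simp only [HahnSeries.coeff_add, HahnSeries.C_mul_eq_smul, HahnSeries.coeff_smul, smul_eq_mul,
    le_orderTop_iff.mp hord i (by omega), add_zero] at h
  refine mul_left_cancel₀ (mul_ne_zero (show (4 : ℂ) ≠ 0 by norm_num) ?_) h
  exact_mod_cast hk.ne'

/-! ### Polynomial parts and their evaluation at t -/

theorem coeff_polyPart₂ (f : LaurentSeries (LaurentSeries ℂ)) (a k : ℕ) :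
    ((polyPart₂ f).coeff a).coeff k = (tjCoeff (-(k : ℤ)) f).coeff (-(a : ℤ)) := by
  rw [polyPart₂, coeff_mapCoeffs _ (by simp [polyPart]), coeff_polyPart, coeff_polyPart,
    coeff_tjCoeff]

theorem coeff_aeval_tL (p : Polynomial ℂ) (i : ℤ) :
    (Polynomial.aeval tL p).coeff i = if i ≤ 0 then p.coeff (-i).toNat else 0 := by
  rw [Polynomial.aeval_eq_sum_range, HahnSeries.coeff_sum]
  simp only [Algebra.smul_def, algebraMap_laurentSeries, HahnSeries.C_mul_eq_smul,
    HahnSeries.coeff_smul, tL, HahnSeries.single_pow, one_pow,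
    HahnSeries.coeff_single, mul_ite, mul_one, mul_zero]
  split_ifs with hi
  · obtain ⟨j, rfl⟩ : ∃ j : ℕ, i = -(j : ℤ) := ⟨(-i).toNat, by omega⟩
    rw [neg_neg, Int.toNat_natCast]
    by_cases hj : j ∈ Finset.range (p.natDegree + 1)
    · rw [Finset.sum_eq_single_of_mem j hj]
      · simp
      · intro b _ hb
        rw [if_neg (by simp; omega)]
    · rw [Finset.sum_eq_zero, Polynomial.coeff_eq_zero_of_natDegree_lt (by simpa using hj)]
      intro b hb
      rw [if_neg (by rintro h; apply hj; simp at h; subst h; exact hb)]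
  · refine Finset.sum_eq_zero fun b _ => if_neg ?_
    simp
    omega

theorem aeval_tL_polyPart {f : LaurentSeries ℂ} (hf : ∀ k : ℤ, 0 < k → f.coeff k = 0) :
    Polynomial.aeval tL (polyPart f) = f := by
  ext i
  rw [coeff_aeval_tL]
  split_ifs with hi
  · rw [coeff_polyPart]; congr 1; omega
  · exact (hf i (by omega)).symm

theorem aeval_tL_derivative (p : Polynomial ℂ) :
    Polynomial.aeval tL (Polynomial.derivative p) = ddt (Polynomial.aeval tL p) := by
  have h := ddtDerivation.map_aeval p tL
  rw [ddtDerivation_apply, ddtDerivation_apply, ddt_tL, smul_eq_mul, mul_one] at h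
  exact h.symm

end

end Lambert

/-- The polynomial part in `t` alone of the kernel form has, after `d/dt_j`, coefficients
polynomial in `t_j`, namely those of `P_n`; and `P_n` is given by the `η`-expression for every
sufficiently long finite sum, that is for every upper limit `M ≥ n + 1`. -/
theorem mainTheorem8 (n M : ℕ) (hM : n + 1 ≤ M) :
    Lambert.mapCoeffs (fun p : Polynomial ℂ => Polynomial.aeval Lambert.tL p)
        (Lambert.residuePoly n) =
      Lambert.mapCoeffs Lambert.ddt (Lambert.polyPart (Lambert.kernelForm n)) ∧
    Lambert.residuePoly n =
      Lambert.mapCoeffs Polynomial.derivative (Lambert.polyPart₂ (Lambert.etaForm n M)) := by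
  constructor
  · refine Polynomial.ext fun a => ?_
    rw [Lambert.coeff_mapCoeffs _ (map_zero _), Lambert.residuePoly,
      Lambert.coeff_mapCoeffs _ Polynomial.derivative_zero, Lambert.polyPart₂,
      Lambert.coeff_mapCoeffs _ (by simp [Lambert.polyPart]),
      Lambert.coeff_mapCoeffs Lambert.ddt (map_zero Lambert.ddtDerivation), Lambert.aeval_tL_derivative,
      Lambert.aeval_tL_polyPart]
    -- The kernel contains no negative power of t_j, so truncating in t_j loses nothing.
    intro k hk
    rw [Lambert.coeff_polyPart, ← Lambert.coeff_tjCoeff, Lambert.tjCoeff_kernelForm_pos n hk,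
      HahnSeries.coeff_zero]
  · refine Polynomial.ext fun a => Polynomial.ext fun k => ?_
    -- After d/dt_j, the coefficient at t_j^k comes from t_j^{k+1}, so only positive exponents have
    -- to be compared.
    rw [Lambert.residuePoly, Lambert.coeff_mapCoeffs _ Polynomial.derivative_zero,
      Lambert.coeff_mapCoeffs _ Polynomial.derivative_zero, Polynomial.coeff_derivative,
      Polynomial.coeff_derivative, Lambert.coeff_polyPart₂, Lambert.coeff_polyPart₂,
      Lambert.coeff_tjCoeff_kernelForm_eq (Nat.succ_pos k) hM (by omega)]
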